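/- **Setting.** For $n\in\mathbb N$ and $1\le i\le N_n$ let $Z_n^i$ be a (nonempty) connected compact Hausdorff space, let $p_n^i=\sum_{k=1}^{R_n^i}p_{n,k}^i$ be a projection in $C(Z_n^i)\otimes M_{r_n^i}$, where the $p_{n,k}^i$ are pairwise orthogonal line bundles (projections that have rank one at every point), and put $A_n=\bigoplus_i A_n^i$ with $A_n^i=p_n^i(C(Z_n^i)\otimes M_{r_n^i})p_n^i$. Let $\phi_n:A_n\to A_{n+1}$ be unital $*$-homomorphisms of generalized diagonal form: the component $A_n^i\to A_{n+1}^j$ is $$\phi_n^{ji}(a)=\sum_{y\in\mathcal Y(n,(j,i))}(a\circ\lambda_y)\otimes q_y ,$$ where $\mathcal Y(n,(j,i))$ is finite, $\lambda_y:Z_{n+1}^j\to Z_n^i$ is continuous, $q_y\in C(Z_{n+1}^j)\otimes M_{s_n^{ji}}$ is $0$ or a line bundle, $r_{n+1}^j=\sum_i r_n^is_n^{ji}$, and the algebras $M_{r_n^i}\otimes M_{s_n^{ji}}$ are the diagonal blocks of $M_{r_{n+1}^j}$. The decompositions of the projections are compatible: if $q_y\neq0$, then $(p_{n,k}^i\circ\lambda_y)\otimes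 q_y$ is one of the $p_{n+1,l}^j$. Let $A=\varinjlim(A_n,\phi_n)$. Put $C_n=\bigoplus_i\bigoplus_k p_{n,k}^i(C(Z_n^i)\otimes M_{r_n^i})p_{n,k}^i\subseteq A_n$; the associated C$^*$-diagonal is $C_A=\varinjlim(C_n,\phi_n)\subseteq A$. A path is a sequence $(y_n)_n$ with $y_n\in\mathcal Y(n,(i_{n+1},i_n))$, $q_{y_n}\ne 0$ and $p_n^{i_n}\neq0$, for some indices $i_n$. Given a path and continuous maps $\gamma_n:Z_{n+1}^{i_{n+1}}\to Z_n^{i_n}$, the inverse limit $Z=\varprojlim(Z_n^{i_n},\gamma_n)$ is called an unseen spectral component of $A$ if no connected component of $\mathrm{Spec}(C_A)$ is homeomorphic to $Z$; $A$ is spectrally incomplete if one exists. Let $\mathbf{AH}$ be the class of C$^*$-algebras isomorphic to finite direct sums of algebras $p(C(X)\otimes M_r)p$ with $X$ connected compact Hausdorff and $p$ a projection. A Cartan subalgebra is a maximal abelian, regular C$^*$-subalgebra that is the range of a faithful conditional expectation. An $\mathbf{AH}$-inductive limit Cartan subalgebra of a C$^*$-algebra $E$ is a Cartan subalgebra of the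 form $D=\varinjlim(D_n,\psi_n)$ for some presentation $E=\varinjlim(E_n,\psi_n)$ with $E_n\in\mathbf{AH}$ and Cartan subalgebras $D_n\subseteq E_n$, $D_n\in\mathbf{AH}$, $\psi_n(D_n)\subseteq D_{n+1}$. It is $\mathbf{AH}$-unique if for every C$^*$-algebra $E'\cong E$ and every $\mathbf{AH}$-inductive limit Cartan subalgebra $D'$ of $E'$ there is a $*$-isomorphism $E\to E'$ that maps $D$ onto $D'$. **Proposition 3.6.** Let $A$ be as above with all $\phi_n$ injective. Suppose that $Z=\varprojlim(Z_n^{i_n},\gamma_n)$ is an unseen spectral component of $A$, belonging to the path $(y_n)_n$. Let $B$ be the AH-algebra, with unital generalized diagonal connecting maps, obtained by replacing $\lambda_{y_n}$ by $\gamma_n$ for all $n$ (the base spaces, the $q_y$, the other $\lambda_y$ and the line bundles of the first stage are kept; the line bundles of the later stages are then determined up to numbering). If $B\cong A$, then $\mathrm{Spec}(C_A)$ and $\mathrm{Spec}(C_B)$ are not homeomorphic, and $A$ does not admit an $\mathbf{AH}$-unique inductive limit Cartan subalgebra. -/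

import Mathlib

open scoped Kronecker ComplexOrder
open Filter Topology

universe u

noncomputable section

namespace AHCartan

/-! ### Projection-valued matrix functions and building blocks -/

/-- The matrix algebra `M_r` with its C*-norm. -/
def Mat (r : ℕ) : Type := CStarMatrix (Fin r) (Fin r) ℂ

instance (r : ℕ) : CStarAlgebra (Mat r) :=
  inferInstanceAs (CStarAlgebra (CStarMatrix (Fin r) (Fin r) ℂ))

/-- Elements of `M_r` as matrices. -/
def Mat.toMatrix {r : ℕ} : Mat r ≃ Matrix (Fin r) (Fin r) ℂ := CStarMatrix.ofMatrix.symm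

section Corner

variable {Z : Type u} [TopologicalSpace Z] [CompactSpace Z] {r : ℕ}

/-- A line bundle in `C(Z) ⊗ M_r = C(Z, M_r)`: a projection that has rank one at every point. -/
def IsLineBundle (p : C(Z, Mat r)) : Prop :=
  IsStarProjection p ∧ ∀ x, (Mat.toMatrix (p x)).rank = 1

/-- The corner `p (C(Z) ⊗ M_r) p`. -/
def corner (p : C(Z, Mat r)) (hp : IsStarProjection p) :
    NonUnitalStarSubalgebra ℂ C(Z, Mat r) where
  carrier := {f | p * f * p = f}
  zero_mem' := by simp
  add_mem' {f g} hf hg := by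
    simp only [Set.mem_ofPred_eq] at *
    rw [mul_add, add_mul, hf, hg]
  smul_mem' c f hf := by
    simp only [Set.mem_ofPred_eq] at *
    rw [mul_smul_comm, smul_mul_assoc, hf]
  mul_mem' {f g} hf hg := by
    simp only [Set.mem_ofPred_eq] at *
    have hpp : p * p = p := hp.isIdempotentElem
    have h1 : p * f = f := by rw [← hf, ← mul_assoc, ← mul_assoc, hpp]
    have h2 : g * p = g := by rw [← hg, mul_assoc, hpp]
    rw [← mul_assoc, h1, mul_assoc, h2]
  star_mem' {f} hf := by
    simp only [Set.mem_ofPred_eq] at *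
    have hs : star p = p := hp.isSelfAdjoint
    have := congrArg star hf
    rw [star_mul, star_mul, hs, ← mul_assoc] at this
    exact this

instance corner_isClosed (p : C(Z, Mat r)) (hp : IsStarProjection p) :
    IsClosed (corner p hp : Set C(Z, Mat r)) :=
  isClosed_eq ((continuous_const.mul continuous_id).mul continuous_const) continuous_id

instance (p : C(Z, Mat r)) (hp : IsStarProjection p) : NonUnitalCStarAlgebra (corner p hp) :=
  NonUnitalStarSubalgebra.nonUnitalCStarAlgebra (corner p hp)

/-- The unit `p` of the corner `p (C(Z) ⊗ M_r) p`. -/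
def cornerUnit (p : C(Z, Mat r)) (hp : IsStarProjection p) : corner p hp :=
  ⟨p, by
    have hpp : p * p = p := hp.isIdempotentElem
    change p * p * p = p
    rw [hpp, hpp]⟩

end Corner

/-- Membership in the class **AH** of building blocks: `A` is *-isomorphic to a finite direct sum
of corners `p (C(Z) ⊗ M_r) p` with `Z` a connected compact Hausdorff space. -/
def IsAHBlock (A : Type u) [NonUnitalNonAssocSemiring A] [Module ℂ A] [Star A] : Prop :=
  ∃ (N : ℕ) (Z : Fin N → Type u) (_ : ∀ i, TopologicalSpace (Z i)) (_ : ∀ i, CompactSpace (Z i))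
    (_ : ∀ i, T2Space (Z i)) (_ : ∀ i, ConnectedSpace (Z i)) (r : Fin N → ℕ)
    (p : ∀ i, C(Z i, Mat (r i))) (hp : ∀ i, IsStarProjection (p i)),
    Nonempty (A ≃⋆ₐ[ℂ] (∀ i, corner (p i) (hp i)))

/-! ### Cartan subalgebras -/

section Cartan

variable {A : Type u} [NonUnitalCStarAlgebra A]

/-- The normalizers `N_A(C) = {n | n C n* ⊆ C and n* C n ⊆ C}`. -/
def normalizers (C : NonUnitalStarSubalgebra ℂ A) : Set A :=
  {n | ∀ c ∈ C, n * c * star n ∈ C ∧ star n * c * n ∈ C}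

/-- `E` is a conditional expectation of `A` onto `C`: a contractive positive linear projection
onto `C` which is a `C`-bimodule map. -/
structure IsConditionalExpectation (C : NonUnitalStarSubalgebra ℂ A) (E : A →ₗ[ℂ] A) : Prop where
  mem : ∀ a, E a ∈ C
  apply_of_mem : ∀ c ∈ C, E c = c
  norm_le : ∀ a, ‖E a‖ ≤ ‖a‖
  positive : ∀ a, ∃ b, E (star a * a) = star b * b
  map_mul_left : ∀ c ∈ C, ∀ a, E (c * a) = c * E a
  map_mul_right : ∀ c ∈ C, ∀ a, E (a * c) = E a * c

/-- Cartan subalgebras: maximal abelian, regular sub-C*-algebras that are the range of a faithful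
conditional expectation. -/
structure IsCartan (C : NonUnitalStarSubalgebra ℂ A) : Prop where
  maximal_abelian : Maximal (fun D : NonUnitalStarSubalgebra ℂ A =>
    IsClosed (D : Set A) ∧ ∀ x ∈ D, ∀ y ∈ D, x * y = y * x) C
  regular : (NonUnitalStarAlgebra.adjoin ℂ (normalizers C)).topologicalClosure = ⊤
  expectation : ∃ E : A →ₗ[ℂ] A, IsConditionalExpectation C E ∧
    ∀ a, E (star a * a) = 0 → a = 0

/-- The spectrum of a commutative C*-subalgebra. -/
abbrev Spec (C : NonUnitalStarSubalgebra ℂ A) : Type u := WeakDual.characterSpace ℂ C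

end Cartan

/-! ### Inductive limits of sequences of C*-algebras -/

section Limit

variable {X : ℕ → Type u} [∀ n, NonUnitalCStarAlgebra (X n)]
  {A : Type u} [NonUnitalCStarAlgebra A]

/-- The composite connecting map `X n → X (n + m)`. -/
def connect (φ : ∀ n, X n →⋆ₙₐ[ℂ] X (n + 1)) (n : ℕ) : ∀ m, X n →⋆ₙₐ[ℂ] X (n + m)
  | 0 => NonUnitalStarAlgHom.id ℂ (X n)
  | m + 1 => (φ (n + m)).comp (connect φ n m)

/-- `A`, with the canonical maps `μ n : X n → A`, is the C*-algebraic inductive limit of `(X, φ)`: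
the maps are compatible, their ranges have dense union, and
`‖μ n a‖ = lim ‖φ_{n, n + m} a‖`. -/
structure IsInductiveLimit (φ : ∀ n, X n →⋆ₙₐ[ℂ] X (n + 1)) (μ : ∀ n, X n →⋆ₙₐ[ℂ] A) :
    Prop where
  compatible : ∀ n a, μ (n + 1) (φ n a) = μ n a
  dense : Dense (⋃ n, Set.range (μ n))
  norm_tendsto : ∀ n a, Tendsto (fun m => ‖connect φ n m a‖) atTop (𝓝 ‖μ n a‖)

/-- The inductive limit of subalgebras `C n ⊆ X n`, as a subalgebra of the limit algebra: the
closure of the union (supremum) of the images of the `C n`. -/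
def limitSubalgebra (μ : ∀ n, X n →⋆ₙₐ[ℂ] A) (C : ∀ n, NonUnitalStarSubalgebra ℂ (X n)) :
    NonUnitalStarSubalgebra ℂ A :=
  (⨆ n, (C n).map (μ n)).topologicalClosure

end Limit

section Unique

/-- `C ⊆ A` is an **AH**-inductive limit Cartan subalgebra: for some presentation of `A` as the
inductive limit of blocks `X n` in **AH**, `C` is a Cartan subalgebra of `A` and is the inductive
limit of Cartan subalgebras `D n ⊆ X n` belonging to **AH**. -/
def IsAHIndLimCartan (A : Type u) [NonUnitalCStarAlgebra A]
    (C : NonUnitalStarSubalgebra ℂ A) : Prop :=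
  ∃ (X : ℕ → Type u) (_ : ∀ n, NonUnitalCStarAlgebra (X n))
    (φ : ∀ n, X n →⋆ₙₐ[ℂ] X (n + 1)) (μ : ∀ n, X n →⋆ₙₐ[ℂ] A)
    (D : ∀ n, NonUnitalStarSubalgebra ℂ (X n)),
    IsInductiveLimit φ μ ∧ (∀ n, IsAHBlock (X n)) ∧ (∀ n, IsAHBlock (D n)) ∧
    (∀ n, IsCartan (D n)) ∧ (∀ n, ∀ d ∈ D n, φ n d ∈ D (n + 1)) ∧
    C = limitSubalgebra μ D ∧ IsCartan C

/-- **AH**-uniqueness of `C ⊆ A`: whenever `B ≅ A` and `D` is an **AH**-inductive limit Cartan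
subalgebra of `B`, some *-isomorphism `A → B` carries `C` onto `D`. -/
def IsAHUnique (A : Type u) [NonUnitalCStarAlgebra A] (C : NonUnitalStarSubalgebra ℂ A) : Prop :=
  ∀ (B : Type u) [NonUnitalCStarAlgebra B] (D : NonUnitalStarSubalgebra ℂ B),
    IsAHIndLimCartan B D → Nonempty (A ≃⋆ₐ[ℂ] B) →
      ∃ f : A ≃⋆ₐ[ℂ] B, f '' (C : Set A) = (D : Set B)

/-- `A` admits an **AH**-unique inductive limit Cartan subalgebra. -/
def AdmitsAHUniqueCartan (A : Type u) [NonUnitalCStarAlgebra A] : Prop :=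
  ∃ C : NonUnitalStarSubalgebra ℂ A, IsAHIndLimCartan A C ∧ IsAHUnique A C

end Unique

/-! ### AH-systems with generalized diagonal connecting maps -/

/-- The data of an AH-system other than the eigenvalue functions and the unit projections: the base
spaces `Z n i` for `i < N n`, matrix sizes `r n i`, ranks `R n i`, the identification `e n j` of
`⊕ i, ℂ^(r n i) ⊗ ℂ^(s n j i)` with `ℂ^(r (n + 1) j)`, the finite index sets `Fin (m n j i)` of the
summands from the `i`-th summand at stage `n` to the `j`-th summand at stage `n + 1`, and the
projections `q`, each zero or a line bundle. -/
structure Base where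
  N : ℕ → ℕ
  Z : ∀ n, Fin (N n) → Type u
  [top : ∀ n i, TopologicalSpace (Z n i)]
  [compact : ∀ n i, CompactSpace (Z n i)]
  [hausdorff : ∀ n i, T2Space (Z n i)]
  [connected : ∀ n i, ConnectedSpace (Z n i)]
  r : ∀ n, Fin (N n) → ℕ
  R : ∀ n, Fin (N n) → ℕ
  s : ∀ n, Fin (N (n + 1)) → Fin (N n) → ℕ
  e : ∀ n j, (Σ i : Fin (N n), Fin (r n i) × Fin (s n j i)) ≃ Fin (r (n + 1) j)
  m : ∀ n, Fin (N (n + 1)) → Fin (N n) → ℕ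
  q : ∀ n j i, Fin (m n j i) → C(Z (n + 1) j, Mat (s n j i))
  q_line : ∀ n j i y, q n j i y = 0 ∨ IsLineBundle (q n j i y)

attribute [instance] Base.top Base.compact Base.hausdorff Base.connected

namespace Base

variable (S : Base.{u})

/-- The block diagonal matrix in `M_(r (n + 1) j)` with blocks `F i` in
`M_(r n i) ⊗ M_(s n j i)`. -/
def assemble (n : ℕ) (j : Fin (S.N (n + 1)))
    (F : ∀ i : Fin (S.N n),
      Matrix (Fin (S.r n i) × Fin (S.s n j i)) (Fin (S.r n i) × Fin (S.s n j i)) ℂ) :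
    Mat (S.r (n + 1) j) :=
  Mat.toMatrix.symm (Matrix.reindex (S.e n j) (S.e n j) (Matrix.blockDiagonal' F))

/-- `a ⊗ b` in `M_r ⊗ M_s`. -/
def tens {r s : ℕ} (a : Mat r) (b : Mat s) : Matrix (Fin r × Fin s) (Fin r × Fin s) ℂ :=
  Mat.toMatrix a ⊗ₖ Mat.toMatrix b

/-- The sequence of nodes and edges of an infinite path in the Bratteli diagram. There are
`R n i = rank p` arrows for each index `y` with nonzero projection `q`. -/
structure Path where
  node : ∀ k, Fin (S.N k)
  edge : ∀ k, Fin (S.m k (node (k + 1)) (node k))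
  q_ne_zero : ∀ k, S.q k (node (k + 1)) (node k) (edge k) ≠ 0
  rank_pos : ∀ k, 0 < S.R k (node k)

variable {S}

/-- The inverse limit of the base spaces along a path, for continuous bonding maps `γ`. -/
def Path.InvLim (π : S.Path) (γ : ∀ k, C(S.Z (k + 1) (π.node (k + 1)), S.Z k (π.node k))) :
    Type u :=
  {x : ∀ k, S.Z k (π.node k) // ∀ k, γ k (x (k + 1)) = x k}

instance (π : S.Path) (γ : ∀ k, C(S.Z (k + 1) (π.node (k + 1)), S.Z k (π.node k))) :
    TopologicalSpace (π.InvLim γ) :=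
  inferInstanceAs (TopologicalSpace {x : ∀ k, S.Z k (π.node k) // ∀ k, γ k (x (k + 1)) = x k})

end Base

/-- A sum of pairwise orthogonal line bundles is a projection. -/
theorem isStarProjection_sum {Z : Type u} [TopologicalSpace Z] [CompactSpace Z] {r R : ℕ}
    (p : Fin R → C(Z, Mat r)) (hp : ∀ k, IsLineBundle (p k))
    (ho : ∀ k l, k ≠ l → p k * p l = 0) : IsStarProjection (∑ k, p k) where
  isIdempotentElem := by
    change (∑ k, p k) * (∑ k, p k) = ∑ k, p k
    rw [Finset.sum_mul_sum]
    refine Finset.sum_congr rfl fun k _ => ?_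
    rw [Finset.sum_eq_single k (fun l _ h => ho k l h.symm) (by simp)]
    exact (hp k).1.isIdempotentElem
  isSelfAdjoint := by
    change star (∑ k, p k) = ∑ k, p k
    rw [star_sum]
    exact Finset.sum_congr rfl fun k _ => (hp k).1.isSelfAdjoint

/-- The unit projections of an AH-system over `S`: at stage `n`, the `i`-th projection is the sum
of the `R n i` pairwise orthogonal line bundles `p n i k`. -/
structure Units (S : Base.{u}) where
  p : ∀ n i, Fin (S.R n i) → C(S.Z n i, Mat (S.r n i))
  p_line : ∀ n i k, IsLineBundle (p n i k)
  p_orth : ∀ n i k l, k ≠ l → p n i k * p n i l = 0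

namespace Units

variable {S : Base.{u}} (U : Units S)

/-- The projection `p_n^i = ∑ k, p_{n,k}^i`. -/
def proj (n : ℕ) (i : Fin (S.N n)) : C(S.Z n i, Mat (S.r n i)) := ∑ k, U.p n i k

theorem proj_isStarProjection (n : ℕ) (i : Fin (S.N n)) : IsStarProjection (U.proj n i) :=
  isStarProjection_sum _ (U.p_line n i) (U.p_orth n i)

/-- The summand `A_n^i = p_n^i (C(Z_n^i) ⊗ M_(r_n^i)) p_n^i`. -/
abbrev Summand (n : ℕ) (i : Fin (S.N n)) : Type u :=
  corner (U.proj n i) (U.proj_isStarProjection n i)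

/-- The building block `A_n = ⊕ i, A_n^i`. -/
def Block (n : ℕ) : Type u := ∀ i, U.Summand n i

instance (n : ℕ) : NonUnitalCStarAlgebra (U.Block n) :=
  inferInstanceAs (NonUnitalCStarAlgebra (∀ i, U.Summand n i))

/-- The `i`-th component of an element of `A_n`, as a matrix-valued function. -/
def coord {U : Units S} {n : ℕ} (a : U.Block n) (i : Fin (S.N n)) : C(S.Z n i, Mat (S.r n i)) :=
  (show ∀ i, U.Summand n i from a) i

/-- The unit of `A_n`. -/
def unit (n : ℕ) : U.Block n := fun i => cornerUnit (U.proj n i) (U.proj_isStarProjection n i)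

theorem p_mul_sum (n : ℕ) (i : Fin (S.N n)) (f : C(S.Z n i, Mat (S.r n i))) (l : Fin (S.R n i)) :
    U.p n i l * ∑ k, U.p n i k * f * U.p n i k = U.p n i l * f * U.p n i l := by
  rw [Finset.mul_sum, Finset.sum_eq_single l]
  · have h : U.p n i l * U.p n i l = U.p n i l := (U.p_line n i l).1.isIdempotentElem
    rw [← mul_assoc, ← mul_assoc, h]
  · intro k _ hk
    rw [← mul_assoc, ← mul_assoc, U.p_orth n i l k hk.symm, zero_mul, zero_mul]
  · simp

theorem sum_mul_p (n : ℕ) (i : Fin (S.N n)) (f : C(S.Z n i, Mat (S.r n i))) (l : Fin (S.R n i)) :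
    (∑ k, U.p n i k * f * U.p n i k) * U.p n i l = U.p n i l * f * U.p n i l := by
  rw [Finset.sum_mul, Finset.sum_eq_single l]
  · have h : U.p n i l * U.p n i l = U.p n i l := (U.p_line n i l).1.isIdempotentElem
    rw [mul_assoc, h]
  · intro k _ hk
    rw [mul_assoc, U.p_orth n i k l hk, mul_zero]
  · simp

/-- The Cartan subalgebra `C_n = ⊕ i, ⊕ k, p_{n,k}^i (C(Z_n^i) ⊗ M_(r_n^i)) p_{n,k}^i` of `A_n`. -/
def diagonal (n : ℕ) : NonUnitalStarSubalgebra ℂ (U.Block n) where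
  carrier := {a | ∀ i, ∑ k, U.p n i k * coord a i * U.p n i k = coord a i}
  zero_mem' i := by
    have h : coord (0 : U.Block n) i = 0 := rfl
    simp [h]
  add_mem' {a b} ha hb i := by
    have h : coord (a + b) i = coord a i + coord b i := rfl
    rw [h]
    conv_rhs => rw [← ha i, ← hb i]
    rw [← Finset.sum_add_distrib]
    exact Finset.sum_congr rfl fun k _ => by rw [mul_add, add_mul]
  smul_mem' c a ha i := by
    have h : coord (c • a) i = c • coord a i := rfl
    rw [h]
    conv_rhs => rw [← ha i]
    rw [Finset.smul_sum]
    exact Finset.sum_congr rfl fun k _ => by rw [mul_smul_comm, smul_mul_assoc]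
  mul_mem' {a b} ha hb i := by
    have h : coord (a * b) i = coord a i * coord b i := rfl
    rw [h]
    conv_rhs => rw [← ha i, Finset.sum_mul]
    refine Finset.sum_congr rfl fun k _ => ?_
    have hb1 := U.p_mul_sum n i (coord b i) k
    have hb2 := U.sum_mul_p n i (coord b i) k
    rw [hb i] at hb1 hb2
    have hb3 : coord b i * U.p n i k = U.p n i k * coord b i := hb2.trans hb1.symm
    simp only [mul_assoc, hb3]
  star_mem' {a} ha i := by
    have h : coord (star a) i = star (coord a i) := rfl
    rw [h]
    conv_rhs => rw [← ha i, star_sum]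
    refine Finset.sum_congr rfl fun k _ => ?_
    have hs : star (U.p n i k) = U.p n i k := (U.p_line n i k).1.isSelfAdjoint
    rw [star_mul, star_mul, hs, mul_assoc]

end Units

/-- An AH-system over `S` with unital generalized diagonal connecting maps
`φ_n^{ji}(a) = ∑ y, (a ∘ λ_y) ⊗ q_y`. -/
structure AHSystem (S : Base.{u}) extends Units S where
  lam : ∀ n j i, Fin (S.m n j i) → C(S.Z (n + 1) j, S.Z n i)
  φ : ∀ n, toUnits.Block n →⋆ₙₐ[ℂ] toUnits.Block (n + 1)
  φ_apply : ∀ n (a : toUnits.Block n) j x, Units.coord (φ n a) j x =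
    S.assemble n j (fun i => ∑ y, Base.tens (Units.coord a i (lam n j i y x)) (S.q n j i y x))
  unital : ∀ n, φ n (toUnits.unit n) = toUnits.unit (n + 1)
  /-- The line bundles `(p_{n,k}^i ∘ λ_y) ⊗ q_y` are among the line bundles into which the unit
  projection of the next stage is decomposed; together with unitality they are all of them. -/
  p_next : ∀ n j i y k, S.q n j i y ≠ 0 → ∃ k', ∀ x,
    p (n + 1) j k' x =
      S.assemble n j (Pi.single i (Base.tens (p n i k (lam n j i y x)) (S.q n j i y x)))

namespace AHSystem

variable {S : Base.{u}}

/-- The associated C*-diagonal `C_A = lim C_n` of the limit `A` of the system. -/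
def assocDiagonal (𝒜 : AHSystem S) {A : Type u} [NonUnitalCStarAlgebra A]
    (μ : ∀ n, 𝒜.Block n →⋆ₙₐ[ℂ] A) : NonUnitalStarSubalgebra ℂ A :=
  limitSubalgebra μ 𝒜.diagonal

/-- The inverse limit along the path `π` with bonding maps `γ` (a Hausdorff continuum) is an unseen
spectral component: no connected component of the spectrum of `C_A` is homeomorphic to it. -/
def IsUnseenComponent (𝒜 : AHSystem S) {A : Type u} [NonUnitalCStarAlgebra A]
    (μ : ∀ n, 𝒜.Block n →⋆ₙₐ[ℂ] A) (π : S.Path)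
    (γ : ∀ k, C(S.Z (k + 1) (π.node (k + 1)), S.Z k (π.node k))) : Prop :=
  ∀ χ : Spec (𝒜.assocDiagonal μ), IsEmpty (connectedComponent χ ≃ₜ π.InvLim γ)

/-- `ℬ` is obtained from `𝒜` by replacing the eigenvalue functions along the path `π` by `γ`: the
other eigenvalue functions and the line bundles at the initial stage are unchanged (those at the
later stages are then determined by the eigenvalue functions, up to numbering). -/
structure IsPathReplacement (𝒜 : AHSystem S) (π : S.Path)
    (γ : ∀ k, C(S.Z (k + 1) (π.node (k + 1)), S.Z k (π.node k))) (ℬ : AHSystem S) : Prop where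
  initial : ∀ i k, ℬ.p 0 i k = 𝒜.p 0 i k
  on_path : ∀ k, ℬ.lam k (π.node (k + 1)) (π.node k) (π.edge k) = γ k
  off_path : ∀ n j i y,
    (⟨j, i, y⟩ : Σ j i, Fin (S.m n j i)) ≠ ⟨π.node (n + 1), π.node n, π.edge n⟩ →
      ℬ.lam n j i y = 𝒜.lam n j i y

end AHSystem

end AHCartan

end

/-!
The spectrum of the diagonal `C_B` contains the inverse limit of every path of `B` as a connected
component: `C_n` is a direct sum of copies of `C(Z_n^i)`, one for each line bundle, and the
connecting maps carry every line bundle to a sum of line bundles of the next stage. So following one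
line bundle along the path gives a map from the inverse limit to `Spec C_B`, by evaluation of the
scalars by which `C_n` acts on the line bundles. Its range is the set of characters with value one
at all the projections of the chosen line bundles, which is an intersection of clopen sets; as the
inverse limit is a continuum, the map is a homeomorphism onto a connected component
(`AHSystem.exists_connectedComponent`). If the inverse limit is unseen in `A`, then `Spec C_A` and
`Spec C_B` are therefore not homeomorphic.

On the other hand `C_A` and `C_B` are both **AH**-inductive limit Cartan subalgebras
(`AHSystem.isAHIndLimCartan_assocDiagonal`). If `C ⊆ A` were **AH**-unique and `A ≅ B`, then there
would be isomorphisms of pairs `(A, C) ≅ (A, C_A)` and `(A, C) ≅ (B, C_B)`, and the spectra of `C_A`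
and `C_B` would be homeomorphic.

The Cartan property needs no injectivity of the connecting maps. It is derived in a general setting
(`PinchSystem.isCartan`). Compression to the diagonal of the line bundles of stage `n` is a
contraction `pinch` on the whole limit algebra; these maps converge pointwise to the conditional
expectation `E`, because each is the previous one followed by a pinching that is trivial on the
image of `A_n`. Whatever commutes with all the line bundles is fixed by `E`, so the diagonal is
maximal abelian. The off-diagonal corners of the `A_n` consist of normalizers, and `E` is
equivariant under them; so `{l | E (l* l) = 0}` is a two-sided ideal. It is zero by the finite index
of the pinching on `A_n` and iterated squaring (`PinchSystem.norm_le_of_near_nullSpace`). The same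
theorem, applied to a constant sequence, shows that `C_n` is Cartan in `A_n`.
-/

noncomputable section

namespace AHCartan

/-! ### Pinchings -/

section Pinch

variable {A : Type u} [NonUnitalCStarAlgebra A] {K : Type*} [Fintype K]

/-- A finite family of pairwise orthogonal projections whose sum acts as a unit. The ambient algebra
is not assumed to be unital, hence the last two fields. -/
structure IsPartition (p : K → A) : Prop where
  proj : ∀ k, IsStarProjection (p k)
  orth : ∀ k l, k ≠ l → p k * p l = 0
  sum_mul : ∀ a, (∑ k, p k) * a = a
  mul_sum : ∀ a, a * ∑ k, p k = a

/-- The pinching `a ↦ ∑ k, p k * a * p k`: the compression to the block diagonal. -/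
def pinch (p : K → A) : A →ₗ[ℂ] A where
  toFun a := ∑ k, p k * a * p k
  map_add' a b := by simp only [mul_add, add_mul, Finset.sum_add_distrib]
  map_smul' c a := by simp only [mul_smul_comm, smul_mul_assoc, Finset.smul_sum, RingHom.id_apply]

theorem pinch_apply (p : K → A) (a : A) : pinch p a = ∑ k, p k * a * p k := rfl

theorem pinch_mul_left {p : K → A} {c : A} (hc : ∀ k, p k * c = c * p k) (a : A) :
    pinch p (c * a) = c * pinch p a := by
  simp only [pinch_apply, Finset.mul_sum]
  exact Finset.sum_congr rfl fun k _ => by rw [← mul_assoc, hc]; simp only [mul_assoc]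

theorem pinch_mul_right {p : K → A} {c : A} (hc : ∀ k, p k * c = c * p k) (a : A) :
    pinch p (a * c) = pinch p a * c := by
  simp only [pinch_apply, Finset.sum_mul]
  exact Finset.sum_congr rfl fun k _ => by simp only [mul_assoc, hc]

namespace IsPartition

variable {p : K → A}

theorem mul_self (hp : IsPartition p) (k : K) : p k * p k = p k := (hp.proj k).isIdempotentElem

theorem star_eq (hp : IsPartition p) (k : K) : star (p k) = p k := (hp.proj k).isSelfAdjoint

theorem mul_pinch (hp : IsPartition p) (k : K) (a : A) : p k * pinch p a = p k * a * p k := by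
  rw [pinch_apply, Finset.mul_sum, Finset.sum_eq_single k]
  · rw [← mul_assoc, ← mul_assoc, hp.mul_self]
  · intro l _ hl
    rw [← mul_assoc, ← mul_assoc, hp.orth k l hl.symm, zero_mul, zero_mul]
  · simp

theorem pinch_mul (hp : IsPartition p) (k : K) (a : A) : pinch p a * p k = p k * a * p k := by
  rw [pinch_apply, Finset.sum_mul, Finset.sum_eq_single k]
  · rw [mul_assoc, hp.mul_self]
  · intro l _ hl
    rw [mul_assoc, hp.orth l k hl, mul_zero]
  · simp

theorem pinch_pinch (hp : IsPartition p) (a : A) : pinch p (pinch p a) = pinch p a := by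
  rw [pinch_apply]
  simp only [hp.mul_pinch, mul_assoc, hp.mul_self]
  simp only [← mul_assoc]
  rfl

theorem commute_of_pinch_eq (hp : IsPartition p) {c : A} (hc : pinch p c = c) (k : K) :
    p k * c = c * p k := by
  have h1 := hp.mul_pinch k c
  have h2 := hp.pinch_mul k c
  rw [hc] at h1 h2
  rw [h1, h2]

theorem pinch_eq_of_commute (hp : IsPartition p) {c : A} (hc : ∀ k, p k * c = c * p k) :
    pinch p c = c := by
  rw [pinch_apply]
  simp only [hc, mul_assoc, hp.mul_self]
  rw [← Finset.mul_sum, hp.mul_sum]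

theorem pinch_corner (hp : IsPartition p) (k : K) (a : A) :
    pinch p (p k * a * p k) = p k * a * p k := by
  refine hp.pinch_eq_of_commute fun j => ?_
  by_cases hj : j = k
  · subst hj
    rw [mul_assoc _ (p j) (p j), hp.mul_self, ← mul_assoc, ← mul_assoc, hp.mul_self]
  · rw [mul_assoc _ (p k) (p j), hp.orth _ _ (Ne.symm hj), ← mul_assoc, ← mul_assoc,
      hp.orth _ _ hj]
    simp

theorem pinch_star (hp : IsPartition p) (a : A) : pinch p (star a) = star (pinch p a) := by
  simp only [pinch_apply, star_sum, star_mul, hp.star_eq, mul_assoc]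

theorem isStarProjection_sum (hp : IsPartition p) : IsStarProjection (∑ k, p k) where
  isIdempotentElem := hp.sum_mul _
  isSelfAdjoint := by
    change star (∑ k, p k) = _
    rw [star_sum]; simp only [hp.star_eq]

/-- The Cauchy–Schwarz inequality for pinchings. -/
theorem norm_pinch_mul_sq_le (hp : IsPartition p) (w l : A) :
    ‖pinch p (w * l)‖ ^ 2 ≤ ‖w‖ ^ 2 * ‖pinch p (star l * l)‖ := by
  let _ : PartialOrder A := CStarAlgebra.spectralOrder A
  have _ : StarOrderedRing A := CStarAlgebra.spectralOrderedRing A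
  have key : star (pinch p (w * l)) * pinch p (w * l) ≤ ‖w‖ ^ 2 • pinch p (star l * l) := by
    have h1 : star (pinch p (w * l)) * pinch p (w * l) =
        ∑ k, star (l * p k) * (star w * p k * w) * (l * p k) := by
      conv_lhs => rw [pinch_apply]
      rw [star_sum, Finset.sum_mul]
      refine Finset.sum_congr rfl fun k _ => ?_
      rw [star_mul, star_mul, hp.star_eq, mul_assoc, mul_assoc, ← pinch_apply, hp.mul_pinch]
      simp only [star_mul, hp.star_eq, mul_assoc]
    have h2 : ‖w‖ ^ 2 • pinch p (star l * l) =
        ∑ k, ‖w‖ ^ 2 • (star (l * p k) * (l * p k)) := by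
      rw [pinch_apply, Finset.smul_sum]
      simp only [star_mul, hp.star_eq, mul_assoc]
    rw [h1, h2]
    refine Finset.sum_le_sum fun k _ => ?_
    -- `b ≤ ‖b‖` for the positive element `b = w* p w`, conjugated by `l * p k`.
    have hb : star w * p k * w = star (p k * w) * (p k * w) := by
      rw [star_mul, hp.star_eq, mul_assoc, mul_assoc, ← mul_assoc (p k) (p k), hp.mul_self]
    have hn : ‖star w * p k * w‖ ≤ ‖w‖ ^ 2 := by
      rw [hb, CStarRing.norm_star_mul_self, sq]
      have : ‖p k * w‖ ≤ ‖w‖ := by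
        refine (norm_mul_le _ _).trans ?_
        have := (hp.proj k).norm_le
        nlinarith [norm_nonneg w]
      gcongr
    refine (CStarAlgebra.star_left_conjugate_le_norm_smul (b := star w * p k * w) ?_).trans ?_
    · rw [hb]; exact IsSelfAdjoint.star_mul_self _
    · exact smul_le_smul_of_nonneg_right hn (star_mul_self_nonneg _)
  have := CStarAlgebra.norm_le_norm_of_nonneg_of_le (star_mul_self_nonneg _) key
  rw [CStarRing.norm_star_mul_self, norm_smul, ← sq, norm_pow, norm_norm] at this
  exact this

theorem norm_pinch_le (hp : IsPartition p) (a : A) : ‖pinch p a‖ ≤ ‖a‖ := by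
  -- Cauchy–Schwarz for `a * 1`, where `∑ k, p k` plays the part of `1`.
  have h := hp.norm_pinch_mul_sq_le a (∑ k, p k)
  rw [hp.mul_sum] at h
  have h2 : pinch p (star (∑ k, p k) * ∑ k, p k) = ∑ k, p k := by
    rw [hp.isStarProjection_sum.isSelfAdjoint.star_eq, hp.sum_mul]
    refine hp.pinch_eq_of_commute fun k => by rw [hp.sum_mul, hp.mul_sum]
  rw [h2] at h
  have h3 := hp.isStarProjection_sum.norm_le
  refine le_of_sq_le_sq ?_ (norm_nonneg _)
  nlinarith [sq_nonneg ‖a‖]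

/-- Pinchings have finite index: `x x* = ∑ k, x (p k) x*`, and the norm of the `k`-th term is that
of the corner `(p k) x* x (p k)`. -/
theorem norm_sq_le_card_mul (hp : IsPartition p) (x : A) :
    ‖x‖ ^ 2 ≤ Fintype.card K * ‖pinch p (star x * x)‖ := by
  have h : x * star x = ∑ k, (x * p k) * star (x * p k) := by
    nth_rw 1 [← hp.mul_sum x]
    rw [mul_assoc, Finset.sum_mul, Finset.mul_sum]
    refine Finset.sum_congr rfl fun k _ => ?_
    rw [star_mul, hp.star_eq, mul_assoc, ← mul_assoc (p k) (p k), hp.mul_self]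
  rw [sq, ← CStarRing.norm_self_mul_star, h]
  refine (norm_sum_le_of_le (f := fun k => (x * p k) * star (x * p k)) (s := Finset.univ)
    (n := fun _ => ‖pinch p (star x * x)‖) fun k _ => ?_).trans (by simp)
  rw [CStarRing.norm_self_mul_star, ← CStarRing.norm_star_mul_self, star_mul, hp.star_eq,
    mul_assoc, ← mul_assoc (star x), ← mul_assoc, ← hp.mul_pinch]
  have := (hp.proj k).norm_le
  refine (norm_mul_le _ _).trans ?_
  nlinarith [norm_nonneg (pinch p (star x * x))]

end IsPartition

end Pinch

/-! ### Cartan subalgebras from compatible pinchings -/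

section PinchSystem

variable {A : Type u} [NonUnitalCStarAlgebra A] {X : ℕ → NonUnitalStarSubalgebra ℂ A}
  {K : ℕ → Type} [∀ n, Fintype (K n)] {p : ∀ n, K n → A}

/-- An increasing sequence of subalgebras `X n` with dense union, together with partitions `p n` in
`X n` whose corners are commutative. Each pinching is obtained from the previous one by a further
pinching, along a finite family that commutes with `X n` and whose pinching fixes `X n`. -/
structure PinchSystem (X : ℕ → NonUnitalStarSubalgebra ℂ A) (p : ∀ n, K n → A) : Prop where
  mono : ∀ n, X n ≤ X (n + 1)
  dense : Dense (⋃ n, (X n : Set A))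
  part : ∀ n, IsPartition (p n)
  mem : ∀ n k, p n k ∈ X n
  comm : ∀ n k, ∀ a ∈ X n, ∀ b ∈ X n,
    (p n k * a * p n k) * (p n k * b * p n k) = (p n k * b * p n k) * (p n k * a * p n k)
  pinch_succ : ∀ n, ∃ (L : Type) (_ : Fintype L) (q : L → A),
    (∀ l, ∀ a ∈ X n, q l * a = a * q l) ∧ (∀ a ∈ X n, pinch q a = a) ∧
    ∀ a, pinch (p (n + 1)) a = pinch q (pinch (p n) a)

namespace PinchSystem

theorem monotone (S : PinchSystem X p) : Monotone X := monotone_nat_of_le_succ S.mono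

theorem pinch_mem (S : PinchSystem X p) {n : ℕ} {a : A} (ha : a ∈ X n) :
    pinch (p n) a ∈ X n :=
  sum_mem fun k _ => mul_mem (mul_mem (S.mem n k) ha) (S.mem n k)

theorem pinch_eq_of_le (S : PinchSystem X p) {n : ℕ} {a : A} (ha : a ∈ X n) {m : ℕ}
    (hm : n ≤ m) : pinch (p m) a = pinch (p n) a := by
  induction m, hm using Nat.le_induction with
  | base => rfl
  | succ m hm ih =>
    obtain ⟨L, _, q, hc, hq, h⟩ := S.pinch_succ m
    rw [h, ih]
    exact hq _ (S.monotone hm (S.pinch_mem ha))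

theorem exists_near (S : PinchSystem X p) (a : A) {ε : ℝ} (hε : 0 < ε) :
    ∃ n, ∃ x ∈ X n, ‖a - x‖ < ε := by
  obtain ⟨x, hx, h⟩ := Metric.mem_closure_iff.1 (S.dense a) ε hε
  obtain ⟨n, hn⟩ := Set.mem_iUnion.1 hx
  exact ⟨n, x, hn, by rwa [← dist_eq_norm]⟩

theorem exists_tendsto (S : PinchSystem X p) (a : A) :
    ∃ e, Tendsto (fun n => pinch (p n) a) atTop (𝓝 e) := by
  refine cauchySeq_tendsto_of_complete (Metric.cauchySeq_iff'.2 fun ε hε => ?_)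
  obtain ⟨n, x, hx, h⟩ := S.exists_near a (half_pos hε)
  refine ⟨n, fun m hm => ?_⟩
  have h1 : pinch (p m) a - pinch (p n) a =
      pinch (p m) (a - x) - pinch (p n) (a - x) := by
    rw [map_sub, map_sub, S.pinch_eq_of_le hx hm]; abel
  rw [dist_eq_norm, h1]
  refine (norm_sub_le _ _).trans_lt ?_
  have h2 := (S.part m).norm_pinch_le (a - x)
  have h3 := (S.part n).norm_pinch_le (a - x)
  linarith

/-- The conditional expectation of a pinch system: the pointwise limit of the pinchings. -/
def expect (S : PinchSystem X p) : A →ₗ[ℂ] A where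
  toFun a := (S.exists_tendsto a).choose
  map_add' a b := by
    refine tendsto_nhds_unique (S.exists_tendsto (a + b)).choose_spec ?_
    simp only [map_add]
    exact (S.exists_tendsto a).choose_spec.add (S.exists_tendsto b).choose_spec
  map_smul' c a := by
    refine tendsto_nhds_unique (S.exists_tendsto (c • a)).choose_spec ?_
    simp only [map_smul]
    exact (S.exists_tendsto a).choose_spec.const_smul c

theorem tendsto_pinch (S : PinchSystem X p) (a : A) :
    Tendsto (fun n => pinch (p n) a) atTop (𝓝 (S.expect a)) := (S.exists_tendsto a).choose_spec

theorem expect_eq_of_eventually (S : PinchSystem X p) {a b : A}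
    (h : ∀ᶠ n in atTop, pinch (p n) a = b) : S.expect a = b :=
  tendsto_nhds_unique (S.tendsto_pinch a)
    (tendsto_const_nhds.congr' (h.mono fun _ hn => hn.symm))

theorem expect_of_mem (S : PinchSystem X p) {n : ℕ} {a : A} (ha : a ∈ X n) :
    S.expect a = pinch (p n) a :=
  S.expect_eq_of_eventually
    ((eventually_ge_atTop n).mono fun _ hm => S.pinch_eq_of_le ha hm)

theorem norm_expect_le (S : PinchSystem X p) (a : A) : ‖S.expect a‖ ≤ ‖a‖ :=
  le_of_tendsto (S.tendsto_pinch a).norm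
    (Eventually.of_forall fun n => (S.part n).norm_pinch_le a)

theorem continuous_expect (S : PinchSystem X p) : Continuous S.expect :=
  AddMonoidHomClass.continuous_of_bound S.expect 1 fun a => by
    rw [one_mul]; exact S.norm_expect_le a

theorem expect_star (S : PinchSystem X p) (a : A) : S.expect (star a) = star (S.expect a) := by
  refine tendsto_nhds_unique (S.tendsto_pinch _) ?_
  simp only [(S.part _).pinch_star]
  exact (continuous_star.tendsto _).comp (S.tendsto_pinch a)

theorem norm_expect_mul_sq_le (S : PinchSystem X p) (w l : A) :
    ‖S.expect (w * l)‖ ^ 2 ≤ ‖w‖ ^ 2 * ‖S.expect (star l * l)‖ :=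
  le_of_tendsto_of_tendsto ((S.tendsto_pinch _).norm.pow 2)
    ((S.tendsto_pinch _).norm.const_mul _)
    (Eventually.of_forall fun n => (S.part n).norm_pinch_mul_sq_le w l)

theorem exists_expect_star_mul_self (S : PinchSystem X p) (a : A) :
    ∃ b, S.expect (star a * a) = star b * b := by
  let _ : PartialOrder A := CStarAlgebra.spectralOrder A
  have _ : StarOrderedRing A := CStarAlgebra.spectralOrderedRing A
  refine CStarAlgebra.nonneg_iff_eq_star_mul_self.1 ?_
  refine CStarAlgebra.isClosed_nonneg.mem_of_tendsto (S.tendsto_pinch (star a * a))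
    (Eventually.of_forall fun n => ?_)
  change 0 ≤ ∑ k, p n k * (star a * a) * p n k
  refine Finset.sum_nonneg fun k _ => ?_
  have h : p n k * (star a * a) * p n k = star (a * p n k) * (a * p n k) := by
    simp only [star_mul, (S.part n).star_eq, mul_assoc]
  rw [h]
  exact star_mul_self_nonneg _

/-- The elements of the off-diagonal corners `p k * X n * p l` intertwine all later pinchings, hence
the expectation. They are the normalizers that span `X n`. -/
theorem pinch_conj (S : PinchSystem X p) {n : ℕ} {a : A} (ha : a ∈ X n) (k l : K n) {m : ℕ}
    (hm : n ≤ m) (x : A) :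
    pinch (p m) (star (p n k * a * p n l) * x * (p n k * a * p n l)) =
      star (p n k * a * p n l) * pinch (p m) x * (p n k * a * p n l) := by
  induction m, hm using Nat.le_induction generalizing x with
  | base =>
    have h1 : star (p n k * a * p n l) * x * (p n k * a * p n l) =
        p n l * (star a * p n k * x * p n k * a) * p n l := by
      simp only [star_mul, (S.part n).star_eq, mul_assoc]
    rw [h1, (S.part n).pinch_corner]
    simp only [star_mul, (S.part n).star_eq]
    have h3 := (S.part n).mul_pinch k x
    have h4 : p n k * pinch (p n) x * p n k = p n k * x * p n k := by
      rw [h3, mul_assoc, (S.part n).mul_self]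
    simp only [mul_assoc] at h4 ⊢
    simp only [← mul_assoc (pinch (p n) x), ← mul_assoc x] at h4 ⊢
    simp only [← mul_assoc (p n k)] at h4 ⊢
    rw [h4]
  | succ m hm ih =>
    obtain ⟨L, _, q, hc, hq, h⟩ := S.pinch_succ m
    have hy : p n k * a * p n l ∈ X m :=
      S.monotone hm (mul_mem (mul_mem (S.mem n k) ha) (S.mem n l))
    rw [h, h, ih, pinch_mul_right fun j => hc j _ hy, pinch_mul_left fun j => hc j _ (star_mem hy)]

theorem expect_conj (S : PinchSystem X p) {n : ℕ} {a : A} (ha : a ∈ X n) (k l : K n) (x : A) :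
    S.expect (star (p n k * a * p n l) * x * (p n k * a * p n l)) =
      star (p n k * a * p n l) * S.expect x * (p n k * a * p n l) := by
  refine tendsto_nhds_unique (S.tendsto_pinch _) ?_
  refine (((S.tendsto_pinch x).const_mul _).mul_const _).congr' ?_
  exact (eventually_ge_atTop n).mono fun m hm => (S.pinch_conj ha k l hm x).symm

theorem sum_corner (S : PinchSystem X p) (n : ℕ) (a : A) :
    ∑ k, ∑ l, p n k * a * p n l = a := by
  simp only [← Finset.mul_sum, (S.part n).mul_sum]
  rw [← Finset.sum_mul, (S.part n).sum_mul]

/-! #### Faithfulness -/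

/-- By the Cauchy–Schwarz inequality. -/
theorem expect_mul_eq_zero (S : PinchSystem X p) {l : A} (hl : S.expect (star l * l) = 0)
    (w : A) : S.expect (w * l) = 0 := by
  have h := S.norm_expect_mul_sq_le w l
  rw [hl, norm_zero, mul_zero] at h
  exact norm_eq_zero.1 (pow_eq_zero_iff two_ne_zero |>.1 (le_antisymm h (sq_nonneg _)))

/-- The null space `{l | E (l* l) = 0}` is a left ideal of the algebra; the description used here
makes it a linear subspace. -/
def nullSpace (S : PinchSystem X p) : Submodule ℂ A where
  carrier := {l | ∀ w, S.expect (w * l) = 0}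
  zero_mem' w := by simp
  add_mem' ha hb w := by rw [mul_add, map_add, ha, hb, add_zero]
  smul_mem' c a ha w := by rw [mul_smul_comm, map_smul, ha, smul_zero]

theorem mul_mem_nullSpace_left (S : PinchSystem X p) {l : A} (hl : l ∈ S.nullSpace) (a : A) :
    a * l ∈ S.nullSpace := fun w => by rw [← mul_assoc]; exact hl _

theorem mul_mem_nullSpace_right (S : PinchSystem X p) {l : A} (hl : l ∈ S.nullSpace) {n : ℕ}
    {a : A} (ha : a ∈ X n) : l * a ∈ S.nullSpace := by
  rw [← S.sum_corner n a, Finset.mul_sum]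
  refine sum_mem fun j _ => ?_
  rw [Finset.mul_sum]
  refine sum_mem fun k _ => fun w => ?_
  refine S.expect_mul_eq_zero ?_ w
  have h : star (l * (p n j * a * p n k)) * (l * (p n j * a * p n k)) =
      star (p n j * a * p n k) * (star l * l) * (p n j * a * p n k) := by
    rw [star_mul]; simp only [mul_assoc]
  rw [h, S.expect_conj ha, hl (star l), mul_zero, zero_mul]

theorem norm_iterate_sq {x : A} (hx : IsSelfAdjoint x) (m : ℕ) :
    IsSelfAdjoint ((fun y : A => y * y)^[m] x) ∧
      ‖(fun y : A => y * y)^[m] x‖ = ‖x‖ ^ (2 ^ m) := by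
  induction m with
  | zero => simpa using hx
  | succ m ih =>
    rw [Function.iterate_succ_apply']
    refine ⟨?_, ?_⟩
    · change star _ = _
      rw [star_mul, ih.1.star_eq]
    · conv_lhs => enter [1, 1]; rw [← ih.1.star_eq]
      rw [CStarRing.norm_star_mul_self, ih.2, ← pow_add]
      congr 1; ring

/-- An element of `X n` that is `ε`-close to a self-adjoint null element has norm at most `ε`: its
iterated squares `y` and the iterated squares `w` of the difference agree modulo the null space,
so `‖y‖ ^ 2 ≤ c * ‖E (y* y)‖ = c * ‖E (w* w)‖ ≤ c * ‖w‖ ^ 2` with `c` the finite index of the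
pinching at stage `n`, which does not depend on the number of iterations. -/
theorem norm_le_of_near_nullSpace (S : PinchSystem X p) {h : A} (hh : h ∈ S.nullSpace) {n : ℕ}
    {y : A} (hy : y ∈ X n) (hsa : IsSelfAdjoint y) (hhsa : IsSelfAdjoint h) :
    ‖y‖ ≤ ‖y - h‖ := by
  set s : A → A := fun y => y * y
  have key : ∀ m, s^[m] y ∈ X n ∧ s^[m] y - s^[m] (y - h) ∈ S.nullSpace := by
    intro m
    induction m with
    | zero => simpa using ⟨hy, hh⟩
    | succ m ih =>
      rw [Function.iterate_succ_apply', Function.iterate_succ_apply']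
      refine ⟨mul_mem ih.1 ih.1, ?_⟩
      have e : s (s^[m] y) - s (s^[m] (y - h)) =
          (s^[m] y - s^[m] (y - h)) * s^[m] y + s^[m] (y - h) * (s^[m] y - s^[m] (y - h)) := by
        simp only [s, sub_mul, mul_sub]; abel
      rw [e]
      exact add_mem (S.mul_mem_nullSpace_right ih.2 ih.1) (S.mul_mem_nullSpace_left ih.2 _)
  have bound : ∀ m, (‖y‖ ^ 2) ^ (2 ^ m) ≤ Fintype.card (K n) * (‖y - h‖ ^ 2) ^ (2 ^ m) := by
    intro m
    obtain ⟨hX, hN⟩ := key m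
    obtain ⟨-, n1⟩ := norm_iterate_sq hsa m
    obtain ⟨-, n2⟩ := norm_iterate_sq (hsa.sub hhsa) m
    set Y := s^[m] y
    set W := s^[m] (y - h)
    have hE : S.expect (star Y * Y) = S.expect (star W * W) := by
      have e : star Y * Y = star W * W + star (star W * (Y - W)) + star Y * (Y - W) := by
        simp only [star_mul, star_star, star_sub, mul_sub]; abel
      rw [e, map_add, map_add, S.expect_star, hN, hN, star_zero, add_zero, add_zero]
    have h1 := (S.part n).norm_sq_le_card_mul Y
    rw [← S.expect_of_mem (mul_mem (star_mem hX) hX), hE] at h1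
    have h2 := S.norm_expect_le (star W * W)
    rw [CStarRing.norm_star_mul_self, n2] at h2
    rw [n1] at h1
    calc (‖y‖ ^ 2) ^ (2 ^ m) = (‖y‖ ^ 2 ^ m) ^ 2 := by rw [← pow_mul, ← pow_mul, mul_comm]
      _ ≤ _ := h1
      _ ≤ Fintype.card (K n) * (‖y - h‖ ^ 2 ^ m * ‖y - h‖ ^ 2 ^ m) := by gcongr
      _ = _ := by rw [← sq, ← pow_mul, ← pow_mul, mul_comm 2]
  by_contra! hlt
  have hpos : 0 < ‖y‖ := (norm_nonneg _).trans_lt hlt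
  -- Otherwise the bound says `1 ≤ c * t ^ (2 ^ m)` for all `m`, with a ratio `t < 1`.
  set t := ‖y - h‖ ^ 2 / ‖y‖ ^ 2
  have ht1 : t < 1 := by
    rw [div_lt_one (by positivity)]; gcongr
  have ht0 : 0 ≤ t := by positivity
  have hlim : Tendsto (fun m : ℕ => (Fintype.card (K n) : ℝ) * t ^ (2 ^ m)) atTop (𝓝 0) := by
    have := ((tendsto_pow_atTop_nhds_zero_of_lt_one ht0 ht1).comp
      (tendsto_pow_atTop_atTop_of_one_lt (one_lt_two (α := ℕ)))).const_mul
        (Fintype.card (K n) : ℝ)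
    simpa using this
  obtain ⟨m, hm⟩ := (hlim.eventually (gt_mem_nhds one_pos)).exists
  have := bound m
  rw [div_pow, ← mul_div_assoc, div_lt_one (by positivity)] at hm
  linarith

theorem expect_faithful (S : PinchSystem X p) {a : A} (ha : S.expect (star a * a) = 0) :
    a = 0 := by
  have hN : star a * a ∈ S.nullSpace :=
    S.mul_mem_nullSpace_left (fun w => S.expect_mul_eq_zero ha w) _
  set h := star a * a
  have hsa : IsSelfAdjoint h := IsSelfAdjoint.star_mul_self a
  suffices ‖h‖ ≤ 0 by
    have h0 : ‖star a * a‖ = 0 := le_antisymm this (norm_nonneg _)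
    rw [CStarRing.norm_star_mul_self] at h0
    exact norm_eq_zero.1 (mul_self_eq_zero.1 h0)
  refine le_of_forall_pos_le_add fun ε hε => ?_
  obtain ⟨n, x, hx, hxh⟩ := S.exists_near h (half_pos hε)
  -- The self-adjoint part of `x` is at least as close to the self-adjoint element `h`.
  set y := (2⁻¹ : ℂ) • (x + star x)
  have hy : y ∈ X n := SMulMemClass.smul_mem _ (add_mem hx (star_mem hx))
  have hysa : IsSelfAdjoint y := by
    change star y = y
    simp only [y, star_smul, star_add, star_star]
    rw [add_comm]; congr 1; simp
  have hyh : ‖y - h‖ ≤ ε / 2 := by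
    have e : y - h = (2⁻¹ : ℂ) • ((x - h) + star (x - h)) := by
      rw [star_sub, hsa.star_eq]
      have : h = (2⁻¹ : ℂ) • (h + h) := by rw [← two_smul ℂ h, smul_smul]; simp
      conv_lhs => rw [this]
      rw [← smul_sub]; congr 1; abel
    rw [e, norm_smul]
    have := norm_add_le (x - h) (star (x - h))
    rw [norm_star, norm_sub_rev] at this
    simp only [norm_inv, Complex.norm_ofNat]
    linarith
  have h1 := S.norm_le_of_near_nullSpace hN hy hysa hsa
  calc ‖h‖ = ‖y - (y - h)‖ := by rw [sub_sub_cancel]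
    _ ≤ ‖y‖ + ‖y - h‖ := norm_sub_le _ _
    _ ≤ 0 + ε := by linarith

/-! #### The Cartan subalgebra -/

/-- The closed union of the fixed-point algebras of the pinchings is a Cartan subalgebra. -/
theorem isCartan (S : PinchSystem X p) {D : ℕ → NonUnitalStarSubalgebra ℂ A}
    (hD : ∀ n a, a ∈ D n ↔ a ∈ X n ∧ pinch (p n) a = a) :
    IsCartan (⨆ n, D n).topologicalClosure := by
  set C := (⨆ n, D n).topologicalClosure with hC
  have hDC : ∀ n, D n ≤ C := fun n =>
    (le_iSup D n).trans (NonUnitalStarSubalgebra.le_topologicalClosure _)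
  have hCclosed : IsClosed (C : Set A) := NonUnitalStarSubalgebra.isClosed_topologicalClosure _
  have hmono : Monotone D := monotone_nat_of_le_succ fun n a ha => by
    rw [hD] at ha ⊢
    exact ⟨S.mono n ha.1, (S.pinch_eq_of_le ha.1 n.le_succ).trans ha.2⟩
  have hcoe : (C : Set A) = closure (⋃ n, (D n : Set A)) := by
    change closure ((⨆ n, D n : NonUnitalStarSubalgebra ℂ A) : Set A) = _
    rw [NonUnitalStarSubalgebra.coe_iSup_of_directed hmono.directed_le]
  have hfix : ∀ c ∈ C, S.expect c = c := by
    intro c hc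
    have hsub : closure (⋃ n, (D n : Set A)) ⊆ {a | S.expect a = a} := by
      refine closure_minimal (Set.iUnion_subset fun n a ha => ?_)
        (isClosed_eq S.continuous_expect continuous_id)
      obtain ⟨h1, h2⟩ := (hD n a).1 ha
      exact (S.expect_of_mem h1).trans h2
    exact hsub (hcoe ▸ hc)
  have hmem : ∀ a, S.expect a ∈ C := by
    intro a
    rw [← SetLike.mem_coe, ← hCclosed.closure_eq]
    refine Metric.mem_closure_iff.2 fun ε hε => ?_
    obtain ⟨n, x, hx, h⟩ := S.exists_near a hε
    refine ⟨S.expect x, hDC n ?_, ?_⟩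
    · rw [S.expect_of_mem hx, hD]
      exact ⟨S.pinch_mem hx, (S.part n).pinch_pinch x⟩
    · rw [dist_eq_norm, ← map_sub]
      exact (S.norm_expect_le _).trans_lt h
  have hpC : ∀ n k, p n k ∈ C := fun n k => hDC n ((hD n _).2 ⟨S.mem n k,
    (S.part n).pinch_eq_of_commute fun l => by
      by_cases hl : l = k
      · rw [hl]
      · rw [(S.part n).orth _ _ hl, (S.part n).orth _ _ (Ne.symm hl)]⟩)
  have hDcomm : ∀ n, ∀ x ∈ D n, ∀ y ∈ D n, x * y = y * x := by
    intro n x hx y hy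
    obtain ⟨hx1, hx2⟩ := (hD n x).1 hx
    obtain ⟨hy1, hy2⟩ := (hD n y).1 hy
    have prod : ∀ a b : A, pinch (p n) a * pinch (p n) b =
        ∑ k, (p n k * a * p n k) * (p n k * b * p n k) := by
      intro a b
      conv_lhs => rw [pinch_apply, Finset.sum_mul]
      refine Finset.sum_congr rfl fun k _ => ?_
      rw [mul_assoc, (S.part n).mul_pinch]
      simp only [mul_assoc]
      rw [← mul_assoc (p n k) (p n k), (S.part n).mul_self]
    rw [← hx2, ← hy2, prod, prod]
    exact Finset.sum_congr rfl fun k _ => S.comm n k x hx1 y hy1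
  have hCcomm : ∀ x ∈ C, ∀ y ∈ C, x * y = y * x := by
    have h1 : ∀ x ∈ ⋃ n, (D n : Set A), ∀ y ∈ ⋃ n, (D n : Set A), x * y = y * x := by
      intro x hx y hy
      obtain ⟨i, hi⟩ := Set.mem_iUnion.1 hx
      obtain ⟨j, hj⟩ := Set.mem_iUnion.1 hy
      exact hDcomm (max i j) x (hmono (le_max_left i j) hi) y (hmono (le_max_right i j) hj)
    intro x hx y hy
    have hx' : x ∈ closure (⋃ n, (D n : Set A)) := hcoe ▸ hx
    have hy' : y ∈ closure (⋃ n, (D n : Set A)) := hcoe ▸ hy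
    have h2 : ∀ x ∈ ⋃ n, (D n : Set A), x * y = y * x := fun x hx =>
      closure_minimal (t := {y | x * y = y * x}) (h1 x hx)
        (isClosed_eq (continuous_const.mul continuous_id) (continuous_id.mul continuous_const)) hy'
    exact closure_minimal (t := {x | x * y = y * x}) h2
      (isClosed_eq (continuous_id.mul continuous_const) (continuous_const.mul continuous_id)) hx'
  refine ⟨⟨⟨hCclosed, hCcomm⟩, ?_⟩, ?_, S.expect, ⟨hmem, hfix, S.norm_expect_le,
    S.exists_expect_star_mul_self, ?_, ?_⟩, fun a => S.expect_faithful⟩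
  · -- An element that commutes with all the projections `p n k` is fixed by the expectation.
    rintro D' ⟨-, hcomm⟩ hle d hd
    have : S.expect d = d := S.expect_eq_of_eventually (Eventually.of_forall fun n =>
      (S.part n).pinch_eq_of_commute fun k => hcomm _ (hle (hpC n k)) _ hd)
    exact this ▸ hmem d
  · -- `X n` is spanned by the off-diagonal corners, which consist of normalizers.
    rw [eq_top_iff]
    rintro a -
    have hsub : closure (⋃ n, (X n : Set A)) ⊆
        closure (NonUnitalStarAlgebra.adjoin ℂ (normalizers C) : Set A) := by
      refine closure_mono (Set.iUnion_subset fun n a ha => ?_)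
      rw [SetLike.mem_coe, ← S.sum_corner n a]
      refine sum_mem fun k _ => sum_mem fun l _ =>
        NonUnitalStarAlgebra.subset_adjoin ℂ _ fun c hc => ⟨?_, ?_⟩
      · have := S.expect_conj (star_mem ha) l k c
        rw [hfix c hc] at this
        have h2 : star (p n l * star a * p n k) = p n k * a * p n l := by
          simp only [star_mul, star_star, (S.part n).star_eq, mul_assoc]
        have h3 : star (p n k * a * p n l) = p n l * star a * p n k := by
          rw [← h2, star_star]
        rw [h2] at this
        rw [h3, ← this]
        exact hmem _
      · have := S.expect_conj ha k l c
        rw [hfix c hc] at this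
        rw [← this]
        exact hmem _
    exact hsub (S.dense a)
  · intro c hc a
    have hsub : closure (⋃ n, (D n : Set A)) ⊆ {c | S.expect (c * a) = c * S.expect a} := by
      refine closure_minimal (Set.iUnion_subset fun n c hc => ?_)
        (isClosed_eq (S.continuous_expect.comp (continuous_id.mul continuous_const))
          (continuous_id.mul continuous_const))
      refine tendsto_nhds_unique (S.tendsto_pinch _) ?_
      refine ((S.tendsto_pinch a).const_mul c).congr' ?_
      refine (eventually_ge_atTop n).mono fun m hm => (pinch_mul_left (fun k => ?_) a).symm
      exact (S.part m).commute_of_pinch_eq ((hD m c).1 (hmono hm hc)).2 k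
    exact hsub (hcoe ▸ hc)
  · intro c hc a
    have hsub : closure (⋃ n, (D n : Set A)) ⊆ {c | S.expect (a * c) = S.expect a * c} := by
      refine closure_minimal (Set.iUnion_subset fun n c hc => ?_)
        (isClosed_eq (S.continuous_expect.comp (continuous_const.mul continuous_id))
          (continuous_const.mul continuous_id))
      refine tendsto_nhds_unique (S.tendsto_pinch _) ?_
      refine ((S.tendsto_pinch a).mul_const c).congr' ?_
      refine (eventually_ge_atTop n).mono fun m hm => (pinch_mul_right (fun k => ?_) a).symm
      exact (S.part m).commute_of_pinch_eq ((hD m c).1 (hmono hm hc)).2 k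
    exact hsub (hcoe ▸ hc)

end PinchSystem

end PinchSystem

/-! ### Rank-one projections and the building blocks -/

/-- Compression by a rank-one matrix is multiplication by a trace; no idempotence is needed. -/
theorem _root_.Matrix.mul_mul_eq_trace_smul_of_rank_eq_one {n : Type*} [Fintype n] [DecidableEq n]
    {p : Matrix n n ℂ} (hp : p.rank = 1) (a : Matrix n n ℂ) :
    p * a * p = (p * a).trace • p := by
  obtain ⟨v, c, rfl⟩ : ∃ v c : n → ℂ, p = Matrix.vecMulVec v c := by
    obtain ⟨v, -, hv⟩ := finrank_eq_one_iff'.1 hp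
    choose c hc using fun j => hv ⟨p.mulVecLin (Pi.single j 1), ⟨_, rfl⟩⟩
    refine ⟨v, c, ?_⟩
    ext i j
    have := congrFun (congrArg Subtype.val (hc j)) i
    simp only [Matrix.mulVecLin_apply, Matrix.mulVec_single_one] at this
    rw [Matrix.vecMulVec_apply, mul_comm]
    simpa using this.symm
  rw [Matrix.vecMulVec_mul, Matrix.trace_vecMulVec, Matrix.vecMulVec_mul_vecMulVec,
    dotProduct_comm]
  ext i j
  simp only [Matrix.vecMulVec_apply, Matrix.smul_apply, Pi.smul_apply, smul_eq_mul]
  ring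

namespace Mat

variable {r : ℕ}

theorem toMatrix_add (a b : Mat r) : toMatrix (a + b) = toMatrix a + toMatrix b := rfl
theorem toMatrix_smul (c : ℂ) (a : Mat r) : toMatrix (c • a) = c • toMatrix a := rfl
theorem toMatrix_zero : toMatrix (0 : Mat r) = 0 := rfl

/-- The trace on `M_r`. -/
def trace : Mat r →ₗ[ℂ] ℂ where
  toFun a := (toMatrix a).trace
  map_add' a b := by rw [toMatrix_add, Matrix.trace_add]
  map_smul' c a := by rw [toMatrix_smul, Matrix.trace_smul, RingHom.id_apply]

theorem continuous_trace : Continuous (trace : Mat r →ₗ[ℂ] ℂ) :=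
  have : FiniteDimensional ℂ (Mat r) :=
    inferInstanceAs (FiniteDimensional ℂ (Matrix (Fin r) (Fin r) ℂ))
  LinearMap.continuous_of_finiteDimensional _

end Mat

section LineBundle

variable {Z : Type u} [TopologicalSpace Z] {r : ℕ} {p : C(Z, Mat r)}

theorem IsLineBundle.mul_self (hp : IsLineBundle p) : p * p = p := hp.1.isIdempotentElem

theorem IsLineBundle.apply_mul_self (hp : IsLineBundle p) (x : Z) : p x * p x = p x :=
  congrArg (fun f : C(Z, Mat r) => f x) hp.mul_self

theorem IsLineBundle.star_eq (hp : IsLineBundle p) : star p = p := hp.1.isSelfAdjoint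

theorem IsLineBundle.apply_ne_zero (hp : IsLineBundle p) (x : Z) : p x ≠ 0 := by
  intro h
  have := hp.2 x
  rw [h, Mat.toMatrix_zero, Matrix.rank_zero] at this
  exact zero_ne_one this

theorem IsLineBundle.ne_zero [Nonempty Z] (hp : IsLineBundle p) : p ≠ 0 := fun h =>
  hp.apply_ne_zero (Classical.arbitrary Z) (by rw [h]; rfl)

theorem IsLineBundle.norm_apply (hp : IsLineBundle p) (x : Z) : ‖p x‖ = 1 := by
  have h1 : ‖p x‖ * ‖p x‖ = ‖p x‖ := by
    rw [← CStarRing.norm_star_mul_self]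
    have : star (p x) = p x := congrArg (fun f : C(Z, Mat r) => f x) hp.star_eq
    rw [this, hp.apply_mul_self]
  have h2 := norm_ne_zero_iff.2 (hp.apply_ne_zero x)
  exact mul_left_cancel₀ h2 (h1.trans (mul_one _).symm)

/-- The scalar function by which the compression of `f` to the line bundle `p` acts. -/
def scalar (p f : C(Z, Mat r)) : C(Z, ℂ) :=
  ⟨fun x => Mat.trace (p x * f x),
    Mat.continuous_trace.comp (p.continuous.mul f.continuous)⟩

theorem IsLineBundle.mul_mul_apply (hp : IsLineBundle p) (f : C(Z, Mat r)) (x : Z) :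
    p x * f x * p x = scalar p f x • p x :=
  Matrix.mul_mul_eq_trace_smul_of_rank_eq_one (hp.2 x) _

theorem IsLineBundle.norm_scalar_le (hp : IsLineBundle p) (f : C(Z, Mat r)) (x : Z) :
    ‖scalar p f x‖ ≤ ‖f x‖ := by
  have h := congrArg norm (hp.mul_mul_apply f x)
  rw [norm_smul, hp.norm_apply, mul_one] at h
  rw [← h]
  refine (norm_mul_le _ _).trans ?_
  rw [hp.norm_apply, mul_one]
  refine (norm_mul_le _ _).trans ?_
  rw [hp.norm_apply, one_mul]

theorem IsLineBundle.corner_comm (hp : IsLineBundle p) (f g : C(Z, Mat r)) :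
    (p * f * p) * (p * g * p) = (p * g * p) * (p * f * p) := by
  ext1 x
  change (p x * f x * p x) * (p x * g x * p x) = (p x * g x * p x) * (p x * f x * p x)
  rw [hp.mul_mul_apply, hp.mul_mul_apply, smul_mul_smul_comm, smul_mul_smul_comm, mul_comm]

end LineBundle

/-- The index set of the line bundles at stage `n`, over all summands. -/
abbrev Base.Idx (S : Base.{u}) (n : ℕ) : Type := Σ i : Fin (S.N n), Fin (S.R n i)

namespace Units

variable {S : Base.{u}} (U : Units S) {n : ℕ}

variable {U} in
theorem ext_coord {a b : U.Block n} (h : ∀ i, coord a i = coord b i) : a = b :=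
  funext fun i => Subtype.ext (h i)

theorem coord_zero (i) : coord (0 : U.Block n) i = 0 := rfl

variable {U}

theorem coord_add (a b : U.Block n) (i) : coord (a + b) i = coord a i + coord b i := rfl
theorem coord_mul (a b : U.Block n) (i) : coord (a * b) i = coord a i * coord b i := rfl
theorem coord_star (a : U.Block n) (i) : coord (star a) i = star (coord a i) := rfl
theorem coord_smul (c : ℂ) (a : U.Block n) (i) : coord (c • a) i = c • coord a i := rfl

theorem coord_sum {ι : Type*} (s : Finset ι) (f : ι → U.Block n) (i) :
    coord (∑ k ∈ s, f k) i = ∑ k ∈ s, coord (f k) i :=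
  map_sum (⟨⟨fun a => coord a i, coord_zero U i⟩, fun a b => coord_add a b i⟩ :
    U.Block n →+ C(S.Z n i, Mat (S.r n i))) f s

theorem coord_corner (a : U.Block n) (i) : U.proj n i * coord a i * U.proj n i = coord a i :=
  ((show ∀ i, U.Summand n i from a) i).2

theorem proj_mul_self (i) : U.proj n i * U.proj n i = U.proj n i :=
  (U.proj_isStarProjection n i).isIdempotentElem

theorem proj_mul_coord (a : U.Block n) (i) : U.proj n i * coord a i = coord a i := by
  rw [← coord_corner, ← mul_assoc, ← mul_assoc, proj_mul_self]

theorem coord_mul_proj (a : U.Block n) (i) : coord a i * U.proj n i = coord a i := by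
  rw [← coord_corner, mul_assoc, proj_mul_self]

theorem norm_coord_apply_le (a : U.Block n) (i) (x) : ‖coord a i x‖ ≤ ‖a‖ :=
  ((coord a i).norm_coe_le_norm x).trans
    (norm_le_pi_norm (show ∀ i, U.Summand n i from a) i)

theorem coord_unit (i) : coord (U.unit n) i = U.proj n i := rfl

theorem unit_mul (a : U.Block n) : U.unit n * a = a :=
  ext_coord fun i => by rw [coord_mul, coord_unit, proj_mul_coord]

theorem mul_unit (a : U.Block n) : a * U.unit n = a :=
  ext_coord fun i => by rw [coord_mul, coord_unit, coord_mul_proj]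

variable (U) in
/-- The element of `A_n` with `i`-th component `f` and all other components zero. -/
def incl (i : Fin (S.N n)) (f : U.Summand n i) : U.Block n :=
  (Pi.single i f : ∀ i, U.Summand n i)

theorem coord_incl_same (i : Fin (S.N n)) (f : U.Summand n i) : coord (U.incl i f) i = f :=
  congrArg Subtype.val (Pi.single_eq_same (M := fun i => U.Summand n i) i f)

theorem coord_incl_of_ne {i j : Fin (S.N n)} (h : j ≠ i) (f : U.Summand n i) :
    coord (U.incl i f) j = 0 :=
  congrArg Subtype.val (Pi.single_eq_of_ne (M := fun i => U.Summand n i) h f)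

theorem p_mul_self (i) (k) : U.p n i k * U.p n i k = U.p n i k := (U.p_line n i k).mul_self

theorem p_mul_proj (i) (k) : U.p n i k * U.proj n i = U.p n i k := by
  rw [proj, Finset.mul_sum, Finset.sum_eq_single k, p_mul_self]
  · exact fun l _ hl => U.p_orth n i k l hl.symm
  · simp

theorem proj_mul_p (i) (k) : U.proj n i * U.p n i k = U.p n i k := by
  rw [proj, Finset.sum_mul, Finset.sum_eq_single k, p_mul_self]
  · exact fun l _ hl => U.p_orth n i l k hl
  · simp

variable (U) in
/-- The multiple `f p_{n,k}^i` of a line bundle by a scalar function, as an element of `A_n`. -/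
def mulLine (K : S.Idx n) (f : C(S.Z n K.1, ℂ)) : U.Block n :=
  U.incl K.1 ⟨f • U.p n K.1 K.2, by
    change U.proj n K.1 * (f • U.p n K.1 K.2) * U.proj n K.1 = _
    have h : ∀ a b c : C(S.Z n K.1, Mat (S.r n K.1)), a * (f • b) * c = f • (a * b * c) := by
      intro a b c
      ext1 x
      change a x * (f x • b x) * c x = f x • (a x * b x * c x)
      rw [mul_smul_comm, smul_mul_assoc]
    rw [h, proj_mul_p, p_mul_proj]⟩

variable (U) in
/-- The line bundle `p_{n,k}^i`, as an element of `A_n`. -/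
def line (K : S.Idx n) : U.Block n :=
  U.incl K.1 ⟨U.p n K.1 K.2, by
    change U.proj n K.1 * U.p n K.1 K.2 * U.proj n K.1 = _
    rw [proj_mul_p, p_mul_proj]⟩

theorem coord_line_same (i) (k : Fin (S.R n i)) : coord (U.line ⟨i, k⟩) i = U.p n i k :=
  coord_incl_same i _

theorem coord_line_of_ne {i j : Fin (S.N n)} (h : j ≠ i) (k : Fin (S.R n i)) :
    coord (U.line ⟨i, k⟩) j = 0 :=
  coord_incl_of_ne (i := i) h _

theorem sum_line : ∑ K, U.line (n := n) K = U.unit n := by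
  refine ext_coord fun i => ?_
  rw [coord_sum, Fintype.sum_sigma, Finset.sum_eq_single i]
  · simp only [coord_line_same]; rfl
  · intro j _ hj
    exact Finset.sum_eq_zero fun k _ => coord_line_of_ne hj.symm k
  · simp

theorem isPartition_line (U : Units S) (n : ℕ) : IsPartition (U.line (n := n)) where
  proj := by
    rintro ⟨i, k⟩
    refine ⟨ext_coord fun j => ?_, ext_coord fun j => ?_⟩
    · rw [coord_mul]
      by_cases h : j = i
      · subst h; rw [coord_line_same, p_mul_self]
      · rw [coord_line_of_ne h, mul_zero]
    · rw [coord_star]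
      by_cases h : j = i
      · subst h; rw [coord_line_same, (U.p_line n j k).star_eq]
      · rw [coord_line_of_ne h, star_zero]
  orth := by
    rintro ⟨i, k⟩ ⟨i', l⟩ hne
    refine ext_coord fun j => ?_
    rw [coord_mul, coord_zero]
    by_cases h : j = i
    · subst h
      by_cases h' : j = i'
      · subst h'
        rw [coord_line_same, coord_line_same, U.p_orth n j k l]
        rintro rfl; exact hne rfl
      · rw [coord_line_of_ne h', mul_zero]
    · rw [coord_line_of_ne h, zero_mul]
  sum_mul a := by rw [sum_line, unit_mul]
  mul_sum a := by rw [sum_line, mul_unit]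

theorem coord_pinch_line (a : U.Block n) (i) :
    coord (pinch U.line a) i = ∑ k, U.p n i k * coord a i * U.p n i k := by
  rw [pinch_apply, coord_sum, Fintype.sum_sigma, Finset.sum_eq_single i]
  · simp only [coord_mul, coord_line_same]
  · intro j _ hj
    refine Finset.sum_eq_zero fun k _ => ?_
    rw [coord_mul, coord_line_of_ne hj.symm, mul_zero]
  · simp

theorem mem_diagonal_iff (a : U.Block n) : a ∈ U.diagonal n ↔ pinch U.line a = a := by
  constructor
  · exact fun h => ext_coord fun i => (coord_pinch_line a i).trans (h i)
  · intro h i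
    rw [← coord_pinch_line, h]

/-- The corners of the line bundles are commutative because compression to a line bundle is
multiplication by a scalar function. -/
theorem line_corner_comm (K : S.Idx n) (a b : U.Block n) :
    (U.line K * a * U.line K) * (U.line K * b * U.line K) =
      (U.line K * b * U.line K) * (U.line K * a * U.line K) := by
  obtain ⟨i, k⟩ := K
  refine ext_coord fun j => ?_
  simp only [coord_mul]
  by_cases h : j = i
  · subst h; rw [coord_line_same, (U.p_line n j k).corner_comm]
  · simp only [coord_line_of_ne h, mul_zero, zero_mul]

theorem isClosed_diagonal (U : Units S) (n : ℕ) : IsClosed (U.diagonal n : Set (U.Block n)) := by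
  have h : (U.diagonal n : Set (U.Block n)) = {a | pinch U.line a = a} :=
    Set.ext fun a => mem_diagonal_iff a
  rw [h]
  refine isClosed_eq ?_ continuous_id
  exact AddMonoidHomClass.continuous_of_bound (pinch U.line) 1 fun a => by
    rw [one_mul]; exact (U.isPartition_line n).norm_pinch_le a

/-- `C_n` is a Cartan subalgebra of `A_n`. -/
theorem isCartan_diagonal (U : Units S) (n : ℕ) : IsCartan (U.diagonal n) := by
  have hS : PinchSystem (fun _ => (⊤ : NonUnitalStarSubalgebra ℂ (U.Block n)))
      (fun _ : ℕ => U.line (n := n)) :=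
    { mono := fun _ => le_rfl
      dense := by
        have : (⋃ _ : ℕ, ((⊤ : NonUnitalStarSubalgebra ℂ (U.Block n)) : Set (U.Block n))) =
            Set.univ := Set.iUnion_const _
        rw [this]; exact dense_univ
      part := fun _ => U.isPartition_line n
      mem := fun _ _ => trivial
      comm := fun _ K a _ b _ => line_corner_comm K a b
      pinch_succ := fun _ => by
        have h : ∀ a, pinch (fun _ : Unit => U.unit n) a = a := fun a => by
          rw [pinch_apply]; simp [unit_mul, mul_unit]
        refine ⟨Unit, inferInstance, fun _ => U.unit n, ?_, fun a _ => h a, fun a => (h _).symm⟩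
        intro _ a _
        rw [unit_mul, mul_unit] }
  have := hS.isCartan (D := fun _ => U.diagonal n) fun _ a => by
    rw [mem_diagonal_iff]; exact ⟨fun h => ⟨trivial, h⟩, fun h => h.2⟩
  rw [iSup_const] at this
  have h2 : (U.diagonal n).topologicalClosure = U.diagonal n :=
    le_antisymm (NonUnitalStarSubalgebra.topologicalClosure_minimal _ le_rfl
      (U.isClosed_diagonal n)) (NonUnitalStarSubalgebra.le_topologicalClosure _)
  rwa [h2] at this

theorem isAHBlock_block (U : Units S) (n : ℕ) : IsAHBlock (U.Block n) :=
  ⟨S.N n, S.Z n, inferInstance, inferInstance, inferInstance, inferInstance, S.r n, U.proj n,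
    U.proj_isStarProjection n, ⟨StarAlgEquiv.refl ℂ (U.Block n)⟩⟩

/-- Elements of the corners of the line bundles assemble to an element of `C_n`. -/
theorem exists_mem_diagonal (U : Units S) {n : ℕ}
    (g : ∀ K : S.Idx n, corner (U.p n K.1 K.2) (U.p_line n K.1 K.2).1) :
    ∃ a ∈ U.diagonal n, ∀ K : S.Idx n, U.p n K.1 K.2 * coord a K.1 = (g K).1 := by
  let G : ∀ i, Fin (S.R n i) → C(S.Z n i, Mat (S.r n i)) := fun i k => (g ⟨i, k⟩).1
  have hg : ∀ i k, U.p n i k * G i k * U.p n i k = G i k :=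
    fun i k => (g ⟨i, k⟩).2
  have hg1 : ∀ i k, U.p n i k * G i k = G i k := by
    intro i k; rw [← hg, ← mul_assoc, ← mul_assoc, p_mul_self]
  have hg2 : ∀ i k, G i k * U.p n i k = G i k := by
    intro i k; rw [← hg, mul_assoc, p_mul_self]
  let a : U.Block n := fun i => ⟨∑ k, G i k, by
    change U.proj n i * _ * U.proj n i = _
    rw [Finset.mul_sum, Finset.sum_mul]
    refine Finset.sum_congr rfl fun k _ => ?_
    rw [← hg, ← mul_assoc, ← mul_assoc, proj_mul_p, mul_assoc, p_mul_proj]⟩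
  have ha : ∀ i l, U.p n i l * coord a i = G i l := by
    intro i l
    change _ * ∑ k, G i k = _
    rw [Finset.mul_sum, Finset.sum_eq_single l, hg1]
    · intro k _ hk
      rw [← hg1, ← mul_assoc, U.p_orth n i l k hk.symm, zero_mul]
    · simp
  refine ⟨a, fun i => ?_, fun K => ha K.1 K.2⟩
  simp only [ha, hg2]
  rfl

theorem p_mul_coord_of_mem {a : U.Block n} (ha : a ∈ U.diagonal n) (i) (k) :
    U.p n i k * coord a i = coord a i * U.p n i k := by
  have h1 := U.p_mul_sum n i (coord a i) k
  have h2 := U.sum_mul_p n i (coord a i) k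
  rw [ha i] at h1 h2
  rw [h1, h2]

/-- The *-homomorphism from `C_n` to the direct sum of the corners of the line bundles, indexed
along a bijection `e`. -/
def toCorners (U : Units S) {n : ℕ} {ι : Type} (e : ι ≃ S.Idx n) : U.diagonal n →⋆ₙₐ[ℂ]
    (∀ t, corner (U.p n (e t).1 (e t).2) (U.p_line n (e t).1 (e t).2).1) where
  toFun := fun a t => ⟨U.p n (e t).1 (e t).2 * coord a.1 (e t).1, by
    change _ * (_ * _) * _ = _
    rw [← mul_assoc, p_mul_self, p_mul_coord_of_mem a.2, mul_assoc, p_mul_self]⟩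
  map_smul' := fun c a => funext fun t => Subtype.ext (by
    change _ * (c • _) = c • (_ * _)
    rw [mul_smul_comm]; rfl)
  map_zero' := funext fun t => Subtype.ext (mul_zero _)
  map_add' := fun a b => funext fun t => Subtype.ext (mul_add _ _ _)
  map_mul' := fun a b => funext fun t => Subtype.ext (by
    change _ * (_ * _) = _ * _ * (_ * _)
    rw [mul_assoc, ← mul_assoc (coord a.1 _), ← p_mul_coord_of_mem a.2, mul_assoc,
      ← mul_assoc (U.p n _ _) (U.p n _ _), p_mul_self]; rfl)
  map_star' := fun a => funext fun t => Subtype.ext (by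
    change _ * star _ = star (_ * _)
    rw [p_mul_coord_of_mem a.2, star_mul, (U.p_line n _ _).star_eq]; rfl)

theorem toCorners_bijective (U : Units S) {n : ℕ} {ι : Type} (e : ι ≃ S.Idx n) :
    Function.Bijective (U.toCorners e) := by
  have hFval : ∀ a t, (U.toCorners e a t : C(S.Z n (e t).1, Mat (S.r n (e t).1))) =
    U.p n (e t).1 (e t).2 * coord a.1 (e t).1 := fun _ _ => rfl
  refine ⟨fun a b hab => ?_, fun g => ?_⟩
  · refine Subtype.ext (ext_coord fun i => ?_)
    rw [← proj_mul_coord, ← proj_mul_coord (b : U.Block n), proj, Finset.sum_mul, Finset.sum_mul]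
    refine Finset.sum_congr rfl fun k _ => ?_
    have h := congrArg Subtype.val (congrFun hab (e.symm ⟨i, k⟩))
    rw [hFval, hFval] at h
    have h2 : ∀ K : S.Idx n, U.p n (e (e.symm K)).1 (e (e.symm K)).2 * coord a.1 (e (e.symm K)).1 =
        U.p n (e (e.symm K)).1 (e (e.symm K)).2 * coord b.1 (e (e.symm K)).1 →
        U.p n K.1 K.2 * coord a.1 K.1 = U.p n K.1 K.2 * coord b.1 K.1 := by
      intro K; rw [e.apply_symm_apply]; exact id
    exact h2 ⟨i, k⟩ h
  · let P : S.Idx n → Type u := fun K => corner (U.p n K.1 K.2) (U.p_line n K.1 K.2).1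
    have hex : ∃ g' : ∀ K, P K, ∀ t, g' (e t) = g t :=
      ⟨Equiv.piCongrLeft P e g, Equiv.piCongrLeft_apply_apply P e g⟩
    obtain ⟨g', hg'⟩ := hex
    obtain ⟨a, ha, h⟩ := U.exists_mem_diagonal g'
    refine ⟨⟨a, ha⟩, funext fun t => Subtype.ext ?_⟩
    exact (h (e t)).trans (congrArg Subtype.val (hg' t))

/-- `C_n` is the direct sum of the corners of the line bundles `p_{n,k}^i`. -/
theorem isAHBlock_diagonal (U : Units S) (n : ℕ) : IsAHBlock (U.diagonal n) := by
  obtain ⟨e⟩ : Nonempty (Fin (Fintype.card (S.Idx n)) ≃ S.Idx n) :=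
    ⟨(Fintype.equivFin (S.Idx n)).symm⟩
  exact ⟨Fintype.card (S.Idx n), fun t => S.Z n (e t).1, inferInstance, inferInstance,
    inferInstance, inferInstance, fun t => S.r n (e t).1, fun t => U.p n (e t).1 (e t).2,
    fun t => (U.p_line n (e t).1 (e t).2).1,
    ⟨StarAlgEquiv.ofBijective (U.toCorners e) (U.toCorners_bijective e)⟩⟩

end Units

/-! ### One connecting map -/

namespace Base

variable (S : Base.{u}) {n : ℕ} {j : Fin (S.N (n + 1))}

/-- The elementary tensor `a ⊗ b`, placed in the `i`-th diagonal block of `M_(r (n + 1) j)`. -/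
def place (n : ℕ) (j : Fin (S.N (n + 1))) (i : Fin (S.N n)) (a : Mat (S.r n i))
    (b : Mat (S.s n j i)) : Mat (S.r (n + 1) j) :=
  S.assemble n j (Pi.single i (tens a b))

theorem assemble_add (F G : ∀ i : Fin (S.N n),
    Matrix (Fin (S.r n i) × Fin (S.s n j i)) (Fin (S.r n i) × Fin (S.s n j i)) ℂ) :
    S.assemble n j (F + G) = S.assemble n j F + S.assemble n j G := by
  unfold assemble
  rw [Matrix.blockDiagonal'_add]
  rfl

theorem assemble_zero : S.assemble n j 0 = 0 := by
  unfold assemble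
  rw [Matrix.blockDiagonal'_zero]
  rfl

theorem assemble_sum {ι : Type*} (s : Finset ι) (F : ι → ∀ i : Fin (S.N n),
    Matrix (Fin (S.r n i) × Fin (S.s n j i)) (Fin (S.r n i) × Fin (S.s n j i)) ℂ) :
    S.assemble n j (∑ k ∈ s, F k) = ∑ k ∈ s, S.assemble n j (F k) :=
  map_sum (⟨⟨S.assemble n j, S.assemble_zero⟩, S.assemble_add⟩ :
    (∀ i : Fin (S.N n), Matrix (Fin (S.r n i) × Fin (S.s n j i))
      (Fin (S.r n i) × Fin (S.s n j i)) ℂ) →+ Mat (S.r (n + 1) j)) F s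

theorem assemble_mul (F G : ∀ i : Fin (S.N n),
    Matrix (Fin (S.r n i) × Fin (S.s n j i)) (Fin (S.r n i) × Fin (S.s n j i)) ℂ) :
    S.assemble n j (F * G) = S.assemble n j F * S.assemble n j G := by
  have h : Matrix.blockDiagonal' (F * G) =
      Matrix.blockDiagonal' F * Matrix.blockDiagonal' G := Matrix.blockDiagonal'_mul F G
  unfold assemble
  rw [h, Matrix.reindex_apply, ← Matrix.submatrix_mul_equiv _ _ _ (S.e n j).symm]
  rfl

theorem place_mul (i : Fin (S.N n)) (a a' : Mat (S.r n i)) (b b' : Mat (S.s n j i)) :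
    S.place n j i a b * S.place n j i a' b' = S.place n j i (a * a') (b * b') := by
  unfold place
  rw [← assemble_mul, ← Pi.single_mul]
  congr 2
  exact (Matrix.mul_kronecker_mul _ _ _ _).symm

theorem place_zero_right (i : Fin (S.N n)) (a : Mat (S.r n i)) :
    S.place n j i a (0 : Mat (S.s n j i)) = 0 := by
  have h : tens a (0 : Mat (S.s n j i)) = 0 := Matrix.kronecker_zero _
  rw [place, h, Pi.single_zero, assemble_zero]

theorem place_zero_left (i : Fin (S.N n)) (b : Mat (S.s n j i)) :
    S.place n j i (0 : Mat (S.r n i)) b = 0 := by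
  have h : tens (0 : Mat (S.r n i)) b = 0 := Matrix.zero_kronecker _
  rw [place, h, Pi.single_zero, assemble_zero]

theorem place_add_left (i : Fin (S.N n)) (a a' : Mat (S.r n i)) (b : Mat (S.s n j i)) :
    S.place n j i (a + a') b = S.place n j i a b + S.place n j i a' b := by
  have h : tens (a + a') b = tens a b + tens a' b := Matrix.add_kronecker _ _ _
  rw [place, h, Pi.single_add, assemble_add]; rfl

theorem place_smul_left (i : Fin (S.N n)) (c : ℂ) (a : Mat (S.r n i)) (b : Mat (S.s n j i)) :
    S.place n j i (c • a) b = c • S.place n j i a b := by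
  have h : tens (c • a) b = c • tens a b := by
    unfold tens; rw [Mat.toMatrix_smul, Matrix.smul_kronecker]
  have h2 : ∀ F : ∀ i : Fin (S.N n), Matrix (Fin (S.r n i) × Fin (S.s n j i))
      (Fin (S.r n i) × Fin (S.s n j i)) ℂ, S.assemble n j (c • F) = c • S.assemble n j F := by
    intro F
    unfold assemble
    rw [Matrix.blockDiagonal'_smul]
    rfl
  rw [place, h, Pi.single_smul, h2]; rfl

theorem place_sum_left {ι : Type*} (s : Finset ι) (i : Fin (S.N n)) (a : ι → Mat (S.r n i))
    (b : Mat (S.s n j i)) : S.place n j i (∑ k ∈ s, a k) b = ∑ k ∈ s, S.place n j i (a k) b :=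
  map_sum (⟨⟨fun a => S.place n j i a b, S.place_zero_left i b⟩,
    fun a a' => S.place_add_left i a a' b⟩ : Mat (S.r n i) →+ Mat (S.r (n + 1) j)) a s

/-- The index set of the summands of the connecting map into the `j`-th summand. -/
abbrev Edge (n : ℕ) (j : Fin (S.N (n + 1))) : Type := Σ i : Fin (S.N n), Fin (S.m n j i)

/-- The index set of the line bundles into which the connecting map splits those of stage `n`. -/
abbrev Arrow (n : ℕ) (j : Fin (S.N (n + 1))) : Type := Σ e : S.Edge n j, Fin (S.R n e.1)

theorem q_mul_self {j : Fin (S.N (n + 1))} (e : S.Edge n j) (x) :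
    S.q n j e.1 e.2 x * S.q n j e.1 e.2 x = S.q n j e.1 e.2 x := by
  rcases S.q_line n j e.1 e.2 with h | h
  · rw [h]; exact mul_zero _
  · exact h.apply_mul_self x

end Base

namespace AHSystem

open AHCartan.Units

variable {S : Base.{u}} (𝒜 : AHSystem S) {n : ℕ} {j : Fin (S.N (n + 1))}

/-- The summand `(a ∘ λ_y) ⊗ q_y` of `φ_n a`, at a point. -/
def term (e : S.Edge n j) (a : 𝒜.Block n) (x : S.Z (n + 1) j) : Mat (S.r (n + 1) j) :=
  S.place n j e.1 (coord a e.1 (𝒜.lam n j e.1 e.2 x)) (S.q n j e.1 e.2 x)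

theorem coord_φ (a : 𝒜.Block n) (x : S.Z (n + 1) j) :
    coord (𝒜.φ n a) j x = ∑ e : S.Edge n j, 𝒜.term e a x := by
  rw [𝒜.φ_apply, Fintype.sum_sigma]
  conv_lhs => rw [← Finset.univ_sum_single (fun i => ∑ y, Base.tens
    (coord a i (𝒜.lam n j i y x)) (S.q n j i y x))]
  rw [S.assemble_sum]
  refine Finset.sum_congr rfl fun i _ => ?_
  have h : ∀ F : Fin (S.m n j i) → Matrix (Fin (S.r n i) × Fin (S.s n j i))
      (Fin (S.r n i) × Fin (S.s n j i)) ℂ, (Pi.single i (∑ y, F y) :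
        ∀ i : Fin (S.N n), Matrix (Fin (S.r n i) × Fin (S.s n j i))
          (Fin (S.r n i) × Fin (S.s n j i)) ℂ) = ∑ y, Pi.single i (F y) := fun F =>
    map_sum (AddMonoidHom.single (fun i : Fin (S.N n) => Matrix (Fin (S.r n i) × Fin (S.s n j i))
          (Fin (S.r n i) × Fin (S.s n j i)) ℂ) i) F _
  rw [h, S.assemble_sum]
  rfl

theorem term_mul_term (e : S.Edge n j) (a b : 𝒜.Block n) (x : S.Z (n + 1) j) :
    𝒜.term e a x * 𝒜.term e b x = 𝒜.term e (a * b) x := by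
  rw [term, term, S.place_mul, S.q_mul_self]; rfl

theorem exists_next (α : S.Arrow n j) : ∃ ρ : C(S.Z (n + 1) j, Mat (S.r (n + 1) j)),
    (∀ x, ρ x = S.place n j α.1.1 (𝒜.p n α.1.1 α.2 (𝒜.lam n j α.1.1 α.1.2 x))
      (S.q n j α.1.1 α.1.2 x)) ∧
    (S.q n j α.1.1 α.1.2 = 0 ∧ ρ = 0 ∨
      S.q n j α.1.1 α.1.2 ≠ 0 ∧ ∃ k, ρ = 𝒜.p (n + 1) j k) := by
  by_cases h : S.q n j α.1.1 α.1.2 = 0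
  · refine ⟨0, fun x => ?_, Or.inl ⟨h, rfl⟩⟩
    rw [h]; exact (S.place_zero_right _ _).symm
  · obtain ⟨k, hk⟩ := 𝒜.p_next n j α.1.1 α.1.2 α.2 h
    exact ⟨𝒜.p (n + 1) j k, hk, Or.inr ⟨h, k, rfl⟩⟩

/-- The projection `(p_{n,k}^i ∘ λ_y) ⊗ q_y`: zero if `q_y` is, else a line bundle of the next
stage. -/
def next (α : S.Arrow n j) : C(S.Z (n + 1) j, Mat (S.r (n + 1) j)) := (𝒜.exists_next α).choose

theorem next_apply (α : S.Arrow n j) (x) : 𝒜.next α x =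
    S.place n j α.1.1 (𝒜.p n α.1.1 α.2 (𝒜.lam n j α.1.1 α.1.2 x)) (S.q n j α.1.1 α.1.2 x) :=
  (𝒜.exists_next α).choose_spec.1 x

theorem next_eq_zero {α : S.Arrow n j} (h : S.q n j α.1.1 α.1.2 = 0) : 𝒜.next α = 0 :=
  (𝒜.exists_next α).choose_spec.2.elim (fun h' => h'.2) fun h' => (h'.1 h).elim

theorem exists_next_eq {α : S.Arrow n j} (h : S.q n j α.1.1 α.1.2 ≠ 0) :
    ∃ k, 𝒜.next α = 𝒜.p (n + 1) j k :=
  (𝒜.exists_next α).choose_spec.2.elim (fun h' => (h h'.1).elim) fun h' => h'.2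

theorem sum_next_eq_term (e : S.Edge n j) (x) :
    ∑ k, 𝒜.next ⟨e, k⟩ x = 𝒜.term e (𝒜.unit n) x := by
  rw [term, coord_unit, proj, ContinuousMap.sum_apply, S.place_sum_left]
  simp only [next_apply]

theorem sum_next : ∑ α : S.Arrow n j, 𝒜.next α = 𝒜.proj (n + 1) j := by
  ext1 x
  rw [ContinuousMap.sum_apply, Fintype.sum_sigma]
  simp only [sum_next_eq_term]
  rw [← coord_φ, 𝒜.unital, coord_unit]

/-- The arrows with nonzero `q` number the line bundles of the next stage: every line bundle `p`
satisfies `p * ∑ next = p`, so it occurs with multiplicity one. -/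
theorem exists_equiv (n : ℕ) (j : Fin (S.N (n + 1))) :
    ∃ κ : {α : S.Arrow n j // S.q n j α.1.1 α.1.2 ≠ 0} ≃ Fin (S.R (n + 1) j),
      ∀ α, 𝒜.next α.1 = 𝒜.p (n + 1) j (κ α) := by
  classical
  choose κ hκ using fun α : {α : S.Arrow n j // S.q n j α.1.1 α.1.2 ≠ 0} =>
    𝒜.exists_next_eq α.2
  suffices hb : Function.Bijective κ from ⟨Equiv.ofBijective κ hb, hκ⟩
  rw [Function.bijective_iff_existsUnique]
  intro l
  have h1 : 𝒜.p (n + 1) j l * ∑ α : S.Arrow n j, 𝒜.next α = 𝒜.p (n + 1) j l := by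
    rw [sum_next, p_mul_proj]
  have hl : 𝒜.p (n + 1) j l ≠ 0 := (𝒜.p_line (n + 1) j l).ne_zero
  have hinj : ∀ k, 𝒜.p (n + 1) j k = 𝒜.p (n + 1) j l → k = l := by
    intro k hk
    by_contra hne
    have h := 𝒜.p_orth (n + 1) j k l hne
    rw [hk, p_mul_self] at h
    exact hl h
  have hterm : ∀ α : S.Arrow n j, 𝒜.p (n + 1) j l * 𝒜.next α =
      if 𝒜.next α = 𝒜.p (n + 1) j l then 𝒜.p (n + 1) j l else 0 := by
    intro α
    split_ifs with h
    · rw [h, p_mul_self]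
    · by_cases hq : S.q n j α.1.1 α.1.2 = 0
      · rw [𝒜.next_eq_zero hq, mul_zero]
      · rw [hκ ⟨α, hq⟩] at h ⊢
        exact 𝒜.p_orth _ _ _ _ fun h' => h (congrArg _ h'.symm)
  rw [Finset.mul_sum, Finset.sum_congr rfl fun α _ => hterm α, ← Finset.sum_filter,
    Finset.sum_const] at h1
  -- By `h1` the number of arrows that lead to the `l`-th line bundle, times it, is it again.
  have hcard : (Finset.univ.filter fun α : S.Arrow n j =>
      𝒜.next α = 𝒜.p (n + 1) j l).card = 1 := by
    set c := (Finset.univ.filter fun α : S.Arrow n j => 𝒜.next α = 𝒜.p (n + 1) j l).card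
    obtain ⟨x⟩ : Nonempty (S.Z (n + 1) j) := inferInstance
    have h2 : (c : ℂ) • 𝒜.p (n + 1) j l x = (1 : ℂ) • 𝒜.p (n + 1) j l x := by
      rw [one_smul, Nat.cast_smul_eq_nsmul]
      exact congrArg (fun f : C(S.Z (n + 1) j, Mat (S.r (n + 1) j)) => f x) h1
    exact_mod_cast smul_left_injective ℂ ((𝒜.p_line (n + 1) j l).apply_ne_zero x) h2
  obtain ⟨α, hα⟩ := Finset.card_eq_one.1 hcard
  have hmem : ∀ β : S.Arrow n j, 𝒜.next β = 𝒜.p (n + 1) j l ↔ β = α := fun β => by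
    rw [← Finset.mem_singleton (a := α), ← hα, Finset.mem_filter]; simp
  have hq : S.q n j α.1.1 α.1.2 ≠ 0 := fun h =>
    hl (((hmem α).2 rfl).symm.trans (𝒜.next_eq_zero h))
  refine ⟨⟨α, hq⟩, hinj _ ((hκ ⟨α, hq⟩).symm.trans ((hmem α).2 rfl)), fun β hβ => ?_⟩
  refine Subtype.ext ((hmem β.1).1 ?_)
  rw [hκ, hβ]

theorem next_mul_next {α β : S.Arrow n j} (h : α ≠ β) : 𝒜.next α * 𝒜.next β = 0 := by
  obtain ⟨κ, hκ⟩ := 𝒜.exists_equiv n j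
  by_cases hα : S.q n j α.1.1 α.1.2 = 0
  · rw [𝒜.next_eq_zero hα, zero_mul]
  by_cases hβ : S.q n j β.1.1 β.1.2 = 0
  · rw [𝒜.next_eq_zero hβ, mul_zero]
  rw [hκ ⟨α, hα⟩, hκ ⟨β, hβ⟩]
  refine 𝒜.p_orth _ _ _ _ fun h' => h ?_
  exact congrArg Subtype.val (κ.injective h')

/-- The summands of `φ_n` have orthogonal ranges. The `q_y` alone need not be orthogonal: the
pull-backs of the unit projection along different `λ_y` may be. -/
theorem term_mul_term_of_ne {e e' : S.Edge n j} (h : e ≠ e') (a b : 𝒜.Block n) (x) :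
    𝒜.term e a x * 𝒜.term e' b x = 0 := by
  have h0 : 𝒜.term e (𝒜.unit n) x * 𝒜.term e' (𝒜.unit n) x = 0 := by
    rw [← sum_next_eq_term, ← sum_next_eq_term, Finset.sum_mul_sum]
    refine Finset.sum_eq_zero fun k _ => Finset.sum_eq_zero fun l _ => ?_
    have hne : (⟨e, k⟩ : S.Arrow n j) ≠ ⟨e', l⟩ := fun h' => h (congrArg Sigma.fst h')
    exact congrArg (fun f : C(S.Z (n + 1) j, Mat (S.r (n + 1) j)) => f x) (𝒜.next_mul_next hne)
  rw [← mul_unit a, ← unit_mul b, ← term_mul_term, ← term_mul_term, mul_assoc,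
    ← mul_assoc (𝒜.term e (𝒜.unit n) x), h0, zero_mul, mul_zero]

theorem coord_φ_mul_term (e : S.Edge n j) (a b : 𝒜.Block n) (x) :
    coord (𝒜.φ n a) j x * 𝒜.term e b x = 𝒜.term e (a * b) x := by
  rw [coord_φ, Finset.sum_mul, Finset.sum_eq_single e, term_mul_term]
  · exact fun e' _ h => 𝒜.term_mul_term_of_ne h _ _ _
  · simp

theorem term_mul_coord_φ (e : S.Edge n j) (a b : 𝒜.Block n) (x) :
    𝒜.term e a x * coord (𝒜.φ n b) j x = 𝒜.term e (a * b) x := by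
  rw [coord_φ, Finset.mul_sum, Finset.sum_eq_single e, term_mul_term]
  · exact fun e' _ h => 𝒜.term_mul_term_of_ne h.symm _ _ _
  · simp

/-- The projection `(p_{n,k}^i ∘ λ_y) ⊗ q_y` as an element of `A_(n + 1)`. -/
def nextLine (j : Fin (S.N (n + 1))) (α : S.Arrow n j) : 𝒜.Block (n + 1) :=
  𝒜.incl j ⟨𝒜.next α, by
    change 𝒜.proj (n + 1) j * 𝒜.next α * 𝒜.proj (n + 1) j = 𝒜.next α
    by_cases h : S.q n j α.1.1 α.1.2 = 0
    · rw [𝒜.next_eq_zero h, mul_zero, zero_mul]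
    · obtain ⟨k, hk⟩ := 𝒜.exists_next_eq h
      rw [hk, proj_mul_p, p_mul_proj]⟩

theorem coord_nextLine_same (α : S.Arrow n j) : coord (𝒜.nextLine j α) j = 𝒜.next α :=
  coord_incl_same j _

theorem coord_nextLine_of_ne {j' : Fin (S.N (n + 1))} (h : j' ≠ j) (α : S.Arrow n j) :
    coord (𝒜.nextLine j α) j' = 0 :=
  coord_incl_of_ne h _

theorem nextLine_eq_line {α : S.Arrow n j} {k} (h : 𝒜.next α = 𝒜.p (n + 1) j k) :
    𝒜.nextLine j α = 𝒜.line ⟨j, k⟩ := by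
  refine ext_coord fun j' => ?_
  by_cases hj : j' = j
  · subst hj; rw [coord_nextLine_same, coord_line_same, h]
  · rw [coord_nextLine_of_ne _ hj, coord_line_of_ne hj]

theorem nextLine_eq_zero {α : S.Arrow n j} (h : S.q n j α.1.1 α.1.2 = 0) :
    𝒜.nextLine j α = 0 := by
  refine ext_coord fun j' => ?_
  by_cases hj : j' = j
  · subst hj; rw [coord_nextLine_same, 𝒜.next_eq_zero h]; rfl
  · rw [coord_nextLine_of_ne _ hj]; rfl

/-- A sum over the line bundles of stage `n + 1` can be taken over the arrows. -/
theorem sum_map_nextLine (n : ℕ) {M : Type*} [AddCommMonoid M] (g : 𝒜.Block (n + 1) → M)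
    (hg : g 0 = 0) :
    ∑ j, ∑ α : S.Arrow n j, g (𝒜.nextLine j α) = ∑ K, g (𝒜.line (n := n + 1) K) := by
  rw [Fintype.sum_sigma]
  refine Finset.sum_congr rfl fun j _ => ?_
  classical
  obtain ⟨κ, hκ⟩ := 𝒜.exists_equiv n j
  rw [← κ.sum_comp]
  simp only [← 𝒜.nextLine_eq_line (hκ _)]
  have h : ∀ α ∈ (Finset.univ : Finset (S.Arrow n j)), g (𝒜.nextLine j α) ≠ 0 →
      S.q n j α.1.1 α.1.2 ≠ 0 := fun α _ h h0 => h (by rw [𝒜.nextLine_eq_zero h0, hg])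
  rw [← Finset.sum_filter_of_ne h]
  exact Finset.sum_subtype _ (fun α => by simp) _

/-- The part of the unit of `A_(n + 1)` that belongs to a single summand `y` of `φ_n`. It commutes
with the range of `φ_n`. -/
def edgeProj (j : Fin (S.N (n + 1))) (e : S.Edge n j) : 𝒜.Block (n + 1) :=
  ∑ k, 𝒜.nextLine j ⟨e, k⟩

theorem coord_edgeProj_same (e : S.Edge n j) (x) :
    coord (𝒜.edgeProj j e) j x = 𝒜.term e (𝒜.unit n) x := by
  rw [edgeProj, coord_sum, ContinuousMap.sum_apply, ← sum_next_eq_term]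
  simp only [coord_nextLine_same]

theorem coord_edgeProj_of_ne {j' : Fin (S.N (n + 1))} (h : j' ≠ j) (e : S.Edge n j) :
    coord (𝒜.edgeProj j e) j' = 0 := by
  rw [edgeProj, coord_sum]
  exact Finset.sum_eq_zero fun k _ => 𝒜.coord_nextLine_of_ne h _

theorem edgeProj_comm (e : S.Edge n j) (a : 𝒜.Block n) :
    𝒜.edgeProj j e * 𝒜.φ n a = 𝒜.φ n a * 𝒜.edgeProj j e := by
  refine ext_coord fun j' => ?_
  rw [coord_mul, coord_mul]
  by_cases hj : j' = j
  · subst hj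
    ext1 x
    rw [ContinuousMap.mul_apply, ContinuousMap.mul_apply, coord_edgeProj_same,
      term_mul_coord_φ, coord_φ_mul_term, unit_mul, mul_unit]
  · rw [coord_edgeProj_of_ne _ hj, zero_mul, mul_zero]

theorem edgeProj_mul_self (e : S.Edge n j) :
    𝒜.edgeProj j e * 𝒜.edgeProj j e = 𝒜.edgeProj j e := by
  refine ext_coord fun j' => ?_
  rw [coord_mul]
  by_cases hj : j' = j
  · subst hj
    ext1 x
    rw [ContinuousMap.mul_apply, coord_edgeProj_same, term_mul_term, unit_mul]
  · rw [coord_edgeProj_of_ne _ hj, zero_mul]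

theorem sum_edgeProj (n : ℕ) : ∑ j, ∑ e : S.Edge n j, 𝒜.edgeProj j e = 𝒜.unit (n + 1) := by
  rw [← sum_line, ← 𝒜.sum_map_nextLine n (fun a => a) rfl]
  exact Finset.sum_congr rfl fun j _ =>
    (Fintype.sum_sigma fun α : S.Arrow n j => 𝒜.nextLine j α).symm

theorem φ_line_mul_edgeProj_same (e : S.Edge n j) (k) :
    𝒜.φ n (𝒜.line ⟨e.1, k⟩) * 𝒜.edgeProj j e = 𝒜.nextLine j ⟨e, k⟩ := by
  refine ext_coord fun j' => ?_
  rw [coord_mul]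
  by_cases hj : j' = j
  · subst hj
    ext1 x
    rw [ContinuousMap.mul_apply, coord_edgeProj_same, coord_φ_mul_term, mul_unit,
      coord_nextLine_same, next_apply, term, coord_line_same]
  · rw [coord_edgeProj_of_ne _ hj, mul_zero, coord_nextLine_of_ne _ hj]

theorem φ_line_mul_edgeProj_of_ne (e : S.Edge n j) {i} (hi : e.1 ≠ i) (k) :
    𝒜.φ n (𝒜.line ⟨i, k⟩) * 𝒜.edgeProj j e = 0 := by
  refine ext_coord fun j' => ?_
  rw [coord_mul]
  by_cases hj : j' = j
  · subst hj
    ext1 x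
    rw [ContinuousMap.mul_apply, coord_edgeProj_same, coord_φ_mul_term, mul_unit, term,
      coord_line_of_ne hi]
    exact S.place_zero_left _ _
  · rw [coord_edgeProj_of_ne _ hj, mul_zero]; rfl

end AHSystem

/-! ### The associated diagonal of the limit -/

namespace AHSystem

open AHCartan.Units

variable {S : Base.{u}} {𝒜 : AHSystem S} {A : Type u} [NonUnitalCStarAlgebra A]
  {μ : ∀ n, 𝒜.Block n →⋆ₙₐ[ℂ] A}

theorem map_unit_eq (hA : IsInductiveLimit 𝒜.φ μ) (n m : ℕ) :
    μ n (𝒜.unit n) = μ m (𝒜.unit m) := by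
  have h : ∀ n, μ n (𝒜.unit n) = μ 0 (𝒜.unit 0) := by
    intro n
    induction n with
    | zero => rfl
    | succ n ih => rw [← ih, ← 𝒜.unital, hA.compatible]
  rw [h n, h m]

theorem map_unit_mul (hA : IsInductiveLimit 𝒜.φ μ) (n : ℕ) (a : A) : μ n (𝒜.unit n) * a = a := by
  have hsub : closure (⋃ n, Set.range (μ n)) ⊆ {a | μ n (𝒜.unit n) * a = a} := by
    refine closure_minimal ?_ (isClosed_eq (continuous_const.mul continuous_id) continuous_id)
    refine Set.iUnion_subset fun m => ?_
    rintro _ ⟨b, rfl⟩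
    change _ * _ = _
    rw [map_unit_eq hA n m, ← map_mul, unit_mul]
  exact hsub (hA.dense a)

theorem mul_map_unit (hA : IsInductiveLimit 𝒜.φ μ) (n : ℕ) (a : A) : a * μ n (𝒜.unit n) = a := by
  have hsub : closure (⋃ n, Set.range (μ n)) ⊆ {a | a * μ n (𝒜.unit n) = a} := by
    refine closure_minimal ?_ (isClosed_eq (continuous_id.mul continuous_const) continuous_id)
    refine Set.iUnion_subset fun m => ?_
    rintro _ ⟨b, rfl⟩
    change _ * _ = _
    rw [map_unit_eq hA n m, ← map_mul, mul_unit]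
  exact hsub (hA.dense a)

theorem isPartition_map_line (hA : IsInductiveLimit 𝒜.φ μ) (n : ℕ) :
    IsPartition fun K : S.Idx n => μ n (𝒜.line K) where
  proj K := by
    refine ⟨?_, ?_⟩
    · change μ n _ * μ n _ = μ n _
      rw [← map_mul, (𝒜.isPartition_line n).mul_self]
    · change star (μ n _) = μ n _
      rw [← map_star, (𝒜.isPartition_line n).star_eq]
  orth K L h := by rw [← map_mul, (𝒜.isPartition_line n).orth K L h, map_zero]
  sum_mul a := by rw [← map_sum, sum_line, map_unit_mul hA]
  mul_sum a := by rw [← map_sum, sum_line, mul_map_unit hA]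

theorem pinch_map_line (n : ℕ) (a : 𝒜.Block n) :
    pinch (fun K : S.Idx n => μ n (𝒜.line K)) (μ n a) = μ n (pinch 𝒜.line a) := by
  simp only [pinch_apply, map_sum, map_mul]

/-- The line bundles of stage `n + 1` are the products of those of stage `n` with the commuting
projections `edgeProj`, so the pinching along them is an iterated pinching. -/
theorem pinch_map_line_succ (hA : IsInductiveLimit 𝒜.φ μ) (n : ℕ) (a : A) :
    pinch (fun K : S.Idx (n + 1) => μ (n + 1) (𝒜.line K)) a =
      pinch (fun t : Σ j, S.Edge n j => μ (n + 1) (𝒜.edgeProj t.1 t.2))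
        (pinch (fun K : S.Idx n => μ n (𝒜.line K)) a) := by
  rw [pinch_apply, pinch_apply,
    ← 𝒜.sum_map_nextLine n (fun b => μ (n + 1) b * a * μ (n + 1) b) (by simp),
    Fintype.sum_sigma]
  refine Finset.sum_congr rfl fun j _ => ?_
  rw [Fintype.sum_sigma]
  refine Finset.sum_congr rfl fun e _ => ?_
  have h : ∀ K : S.Idx n, μ (n + 1) (𝒜.edgeProj j e) * (μ n (𝒜.line K) * a * μ n (𝒜.line K)) *
      μ (n + 1) (𝒜.edgeProj j e) =
      μ (n + 1) (𝒜.φ n (𝒜.line K) * 𝒜.edgeProj j e) * a *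
        μ (n + 1) (𝒜.φ n (𝒜.line K) * 𝒜.edgeProj j e) := by
    intro K
    conv_rhs => enter [1, 1]; rw [← edgeProj_comm]
    rw [map_mul, map_mul, hA.compatible]
    simp only [mul_assoc]
  rw [pinch_apply, Finset.mul_sum, Finset.sum_mul]
  simp only [h]
  rw [Fintype.sum_sigma, Finset.sum_eq_single e.1]
  · simp only [φ_line_mul_edgeProj_same]
  · intro i _ hi
    refine Finset.sum_eq_zero fun k _ => ?_
    rw [φ_line_mul_edgeProj_of_ne _ e hi.symm, map_zero, mul_zero]
  · simp

theorem pinchSystem (hA : IsInductiveLimit 𝒜.φ μ) :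
    PinchSystem (fun n => NonUnitalStarAlgHom.range (μ n))
      (fun n (K : S.Idx n) => μ n (𝒜.line K)) where
  mono n := by
    rintro _ ⟨a, rfl⟩
    exact ⟨𝒜.φ n a, hA.compatible n a⟩
  dense := by
    have h : (⋃ n, (NonUnitalStarAlgHom.range (μ n) : Set A)) = ⋃ n, Set.range (μ n) :=
      Set.iUnion_congr fun n => NonUnitalStarAlgHom.coe_range (μ n)
    rw [h]; exact hA.dense
  part := isPartition_map_line hA
  mem n K := ⟨𝒜.line K, rfl⟩
  comm n K := by
    rintro _ ⟨a, rfl⟩ _ ⟨b, rfl⟩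
    change (μ n _ * μ n a * μ n _) * (μ n _ * μ n b * μ n _) =
      (μ n _ * μ n b * μ n _) * (μ n _ * μ n a * μ n _)
    simp only [← map_mul]
    rw [line_corner_comm]
  pinch_succ n := by
    refine ⟨Σ j, S.Edge n j, inferInstance, fun t => μ (n + 1) (𝒜.edgeProj t.1 t.2), ?_, ?_,
      pinch_map_line_succ hA n⟩
    · rintro ⟨j, e⟩ _ ⟨a, rfl⟩
      change _ * μ n a = μ n a * _
      rw [← hA.compatible, ← map_mul, ← map_mul, edgeProj_comm]
    · rintro _ ⟨a, rfl⟩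
      change pinch _ (μ n a) = μ n a
      rw [← hA.compatible, pinch_apply]
      simp only [← map_mul, edgeProj_comm, mul_assoc, edgeProj_mul_self]
      rw [← map_sum, ← Finset.mul_sum, Fintype.sum_sigma, sum_edgeProj, mul_unit]

/-- `C_A` is a Cartan subalgebra of `A`, whether or not the connecting maps are injective. -/
theorem isCartan_assocDiagonal (hA : IsInductiveLimit 𝒜.φ μ) :
    IsCartan (𝒜.assocDiagonal μ) := by
  refine (pinchSystem hA).isCartan fun n a => ⟨?_, ?_⟩
  · rintro ⟨b, hb, rfl⟩
    refine ⟨⟨b, rfl⟩, ?_⟩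
    change pinch _ (μ n b) = μ n b
    rw [pinch_map_line, (mem_diagonal_iff b).1 hb]
  · rintro ⟨⟨b, rfl⟩, h⟩
    change pinch _ (μ n b) = μ n b at h
    refine ⟨pinch 𝒜.line b, (mem_diagonal_iff _).2 ((𝒜.isPartition_line n).pinch_pinch b), ?_⟩
    exact (pinch_map_line n b).symm.trans h

theorem φ_mem_diagonal (n : ℕ) {a : 𝒜.Block n} (ha : a ∈ 𝒜.diagonal n) :
    𝒜.φ n a ∈ 𝒜.diagonal (n + 1) := by
  rw [mem_diagonal_iff]
  refine (𝒜.isPartition_line (n + 1)).pinch_eq_of_commute ?_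
  rintro ⟨j, k⟩
  obtain ⟨κ, hκ⟩ := 𝒜.exists_equiv n j
  obtain ⟨⟨⟨e, l⟩, hq⟩, rfl⟩ := κ.surjective k
  rw [← 𝒜.nextLine_eq_line (hκ _), ← φ_line_mul_edgeProj_same, mul_assoc, edgeProj_comm,
    ← mul_assoc, ← mul_assoc, ← map_mul, ← map_mul,
    (𝒜.isPartition_line n).commute_of_pinch_eq ((mem_diagonal_iff a).1 ha)]

theorem isAHIndLimCartan_assocDiagonal (hA : IsInductiveLimit 𝒜.φ μ) :
    IsAHIndLimCartan A (𝒜.assocDiagonal μ) :=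
  ⟨𝒜.Block, inferInstance, 𝒜.φ, μ, 𝒜.diagonal, hA, 𝒜.isAHBlock_block, 𝒜.isAHBlock_diagonal,
    𝒜.isCartan_diagonal, fun n _ hd => φ_mem_diagonal n hd, rfl, isCartan_assocDiagonal hA⟩

end AHSystem

/-! ### Inverse limits of continua -/

section InverseLimit

variable {Z : ℕ → Type u} [∀ k, TopologicalSpace (Z k)]

/-- The sequences that satisfy the first `N` conditions of the inverse limit. -/
def partialThreads (γ : ∀ k, C(Z (k + 1), Z k)) (N : ℕ) : Set (∀ k, Z k) :=
  {x | ∀ k < N, γ k (x (k + 1)) = x k}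

theorem isClosed_partialThreads [∀ k, T2Space (Z k)] (γ : ∀ k, C(Z (k + 1), Z k)) (N : ℕ) :
    IsClosed (partialThreads γ N) := by
  have h : partialThreads γ N = ⋂ k, ⋂ _ : k < N, {x | γ k (x (k + 1)) = x k} := by
    ext x; simp [partialThreads]
  rw [h]
  exact isClosed_iInter fun k => isClosed_iInter fun _ =>
    isClosed_eq ((γ k).continuous.comp (continuous_apply _)) (continuous_apply _)

theorem partialThreads_antitone (γ : ∀ k, C(Z (k + 1), Z k)) : Antitone (partialThreads γ) :=
  fun _ _ h _ hx k hk => hx k (hk.trans_le h)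

/-- The partial threads are a retract of the product: the first `N` coordinates are overwritten,
from the top down. -/
theorem exists_retraction (γ : ∀ k, C(Z (k + 1), Z k)) (N : ℕ) :
    ∃ ρ : (∀ k, Z k) → ∀ k, Z k, Continuous ρ ∧ Set.range ρ = partialThreads γ N ∧
      ∀ x, ∀ k ≥ N, ρ x k = x k := by
  classical
  induction N with
  | zero =>
    refine ⟨id, continuous_id, ?_, fun _ _ _ => rfl⟩
    ext x; simp [partialThreads]
  | succ N ih =>
    obtain ⟨ρ, hc, hr, hk⟩ := ih
    refine ⟨fun x => ρ (Function.update x N (γ N (x (N + 1)))), ?_, ?_, ?_⟩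
    · exact hc.comp (continuous_id.update N ((γ N).continuous.comp (continuous_apply _)))
    · ext y
      constructor
      · rintro ⟨x, rfl⟩ k hkN
        rcases Nat.lt_succ_iff_lt_or_eq.1 hkN with h | rfl
        · have hmem : ρ (Function.update x N (γ N (x (N + 1)))) ∈ partialThreads γ N :=
            hr ▸ ⟨_, rfl⟩
          exact hmem k h
        · dsimp only
          rw [hk _ (k + 1) (Nat.le_succ k), hk _ k le_rfl]
          simp
      · intro hy
        have hy' : y ∈ Set.range ρ := hr ▸ fun k h => hy k (h.trans N.lt_succ_self)
        obtain ⟨x, rfl⟩ := hy'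
        refine ⟨x, ?_⟩
        have h1 := hy N N.lt_succ_self
        rw [hk _ _ (Nat.le_succ N), hk _ _ le_rfl] at h1
        change ρ _ = _
        rw [h1, Function.update_eq_self]
    · intro x k hkN
      dsimp only
      rw [hk _ _ (Nat.le_of_succ_le hkN), Function.update_of_ne (by omega)]

theorem isConnected_partialThreads [∀ k, ConnectedSpace (Z k)] (γ : ∀ k, C(Z (k + 1), Z k))
    (N : ℕ) : IsConnected (partialThreads γ N) := by
  obtain ⟨ρ, hc, hr, -⟩ := exists_retraction γ N
  rw [← hr]
  exact isConnected_range hc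

/-- An inverse limit of continua is a continuum: it is a decreasing intersection of the compact
connected sets of partial threads. -/
theorem isConnected_threads [∀ k, CompactSpace (Z k)] [∀ k, T2Space (Z k)]
    [∀ k, ConnectedSpace (Z k)] (γ : ∀ k, C(Z (k + 1), Z k)) :
    IsConnected {x : ∀ k, Z k | ∀ k, γ k (x (k + 1)) = x k} := by
  have hL : {x : ∀ k, Z k | ∀ k, γ k (x (k + 1)) = x k} = ⋂ N, partialThreads γ N := by
    ext x
    simp only [Set.mem_ofPred_eq, Set.mem_iInter, partialThreads]
    exact ⟨fun h N k _ => h k, fun h k => h (k + 1) k k.lt_succ_self⟩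
  have hcomp : ∀ N, IsCompact (partialThreads γ N) := fun N =>
    (isClosed_partialThreads γ N).isCompact
  rw [hL]
  refine ⟨IsCompact.nonempty_iInter_of_sequence_nonempty_isCompact_isClosed _
    (fun N => partialThreads_antitone γ N.le_succ)
    (fun N => (isConnected_partialThreads γ N).nonempty) (hcomp 0)
    (isClosed_partialThreads γ), ?_⟩
  rw [isPreconnected_closed_iff]
  intro s t hs ht hst hLs hLt
  by_contra hne
  have hLc : IsClosed (⋂ N, partialThreads γ N) := isClosed_iInter (isClosed_partialThreads γ)
  have hdisj : Disjoint ((⋂ N, partialThreads γ N) ∩ s) ((⋂ N, partialThreads γ N) ∩ t) := by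
    rw [Set.disjoint_iff_inter_eq_empty, ← Set.inter_inter_distrib_left]
    exact Set.not_nonempty_iff_eq_empty.1 hne
  obtain ⟨U, V, hU, hV, hsU, htV, hUV⟩ :=
    SeparatedNhds.of_isCompact_isCompact (hLc.inter hs).isCompact (hLc.inter ht).isCompact hdisj
  have hsub : ⋂ N, partialThreads γ N ⊆ U ∪ V := fun x hx =>
    (hst hx).elim (fun h => Or.inl (hsU ⟨hx, h⟩)) fun h => Or.inr (htV ⟨hx, h⟩)
  obtain ⟨N, hN⟩ := exists_subset_nhds_of_isCompact
    (partialThreads_antitone γ).directed_ge hcomp fun x hx => (hU.union hV).mem_nhds (hsub hx)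
  have hLN := Set.iInter_subset (partialThreads γ) N
  obtain ⟨x, -, hx⟩ := (isConnected_partialThreads γ N).isPreconnected U V hU hV hN
    (hLs.mono fun x hx => ⟨hLN hx.1, hsU hx⟩) (hLt.mono fun x hx => ⟨hLN hx.1, htV hx⟩)
  exact Set.disjoint_left.1 hUV hx.1 hx.2

end InverseLimit

namespace Base.Path

variable {S : Base.{u}} (π : S.Path)
  (γ : ∀ k, C(S.Z (k + 1) (π.node (k + 1)), S.Z k (π.node k)))

theorem connectedSpace_invLim : ConnectedSpace (π.InvLim γ) := by
  have h := isConnected_iff_connectedSpace.1 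
    (isConnected_threads (Z := fun k => S.Z k (π.node k)) γ)
  exact h

theorem compactSpace_invLim : CompactSpace (π.InvLim γ) := by
  have hc : IsClosed {x : ∀ k, S.Z k (π.node k) | ∀ k, γ k (x (k + 1)) = x k} := by
    simp only [Set.ofPred_forall]
    exact isClosed_iInter fun k =>
      isClosed_eq ((γ k).continuous.comp (continuous_apply _)) (continuous_apply _)
  exact isCompact_iff_compactSpace.1 hc.isCompact

theorem continuous_invLim_apply (k : ℕ) : Continuous fun z : π.InvLim γ => z.1 k :=
  (continuous_apply k).comp continuous_subtype_val

end Base.Path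

/-! ### Functionals on inductive limits -/

section Functional

variable {X : ℕ → Type u} [∀ n, NonUnitalCStarAlgebra (X n)] {A : Type u}
  [NonUnitalCStarAlgebra A] {φ : ∀ n, X n →⋆ₙₐ[ℂ] X (n + 1)} {μ : ∀ n, X n →⋆ₙₐ[ℂ] A}

theorem IsInductiveLimit.map_connect (h : IsInductiveLimit φ μ) (n m : ℕ) (a : X n) :
    μ (n + m) (connect φ n m a) = μ n a := by
  induction m with
  | zero => rfl
  | succ m ih => exact (h.compatible (n + m) _).trans ih

theorem IsInductiveLimit.exists_common (h : IsInductiveLimit φ μ) {n m : ℕ} (a : X n) (b : X m) :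
    ∃ l, ∃ a' b' : X l, μ l a' = μ n a ∧ μ l b' = μ m b := by
  rcases le_total n m with hnm | hnm
  · obtain ⟨d, rfl⟩ := Nat.exists_eq_add_of_le hnm
    exact ⟨_, connect φ n d a, b, h.map_connect n d a, rfl⟩
  · obtain ⟨d, rfl⟩ := Nat.exists_eq_add_of_le hnm
    exact ⟨_, a, connect φ m d b, rfl, h.map_connect m d b⟩

/-- A compatible sequence of contractive functionals on the stages extends to the limit. -/
theorem IsInductiveLimit.exists_functional (h : IsInductiveLimit φ μ) (f : ∀ n, X n →ₗ[ℂ] ℂ)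
    (hc : ∀ n a, f (n + 1) (φ n a) = f n a) (hb : ∀ n a, ‖f n a‖ ≤ ‖a‖) :
    ∃ F : A →L[ℂ] ℂ, (∀ a, ‖F a‖ ≤ ‖a‖) ∧ ∀ n a, F (μ n a) = f n a := by
  have hconn : ∀ n m a, f (n + m) (connect φ n m a) = f n a := by
    intro n m a
    induction m with
    | zero => rfl
    | succ m ih => exact (hc (n + m) _).trans ih
  have hbound : ∀ n a, ‖f n a‖ ≤ ‖μ n a‖ := fun n a =>
    ge_of_tendsto (h.norm_tendsto n a) (Eventually.of_forall fun m => by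
      rw [← hconn n m a]; exact hb _ _)
  have heq : ∀ n (a b : X n), μ n a = μ n b → f n a = f n b := by
    intro n a b hab
    have := hbound n (a - b)
    rw [map_sub, map_sub, hab, sub_self, norm_zero] at this
    exact sub_eq_zero.1 (norm_le_zero_iff.1 this)
  have heq' : ∀ n m (a : X n) (b : X m), μ n a = μ m b → f n a = f m b := by
    intro n m a b hab
    rcases le_total n m with hnm | hnm
    · obtain ⟨d, rfl⟩ := Nat.exists_eq_add_of_le hnm
      rw [← hconn n d]
      exact heq _ _ _ ((h.map_connect n d a).trans hab)
    · obtain ⟨d, rfl⟩ := Nat.exists_eq_add_of_le hnm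
      rw [← hconn m d]
      exact heq _ _ _ (hab.trans (h.map_connect m d b).symm)
  -- The functionals define a contractive functional on the union of the ranges, which is a
  -- subspace; the Hahn–Banach theorem extends it to the whole algebra.
  let V : Submodule ℂ A :=
    { carrier := {x | ∃ n a, μ n a = x}
      zero_mem' := ⟨0, 0, map_zero _⟩
      add_mem' := by
        rintro _ _ ⟨n, a, rfl⟩ ⟨m, b, rfl⟩
        obtain ⟨l, a', b', h1, h2⟩ := h.exists_common a b
        exact ⟨l, a' + b', by rw [map_add, h1, h2]⟩
      smul_mem' := by
        rintro c _ ⟨n, a, rfl⟩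
        exact ⟨n, c • a, map_smul _ _ _⟩ }
  have hV : ∀ x : V, ∃ n a, μ n a = x.1 := fun x => x.2
  choose N a ha using hV
  let g : V →ₗ[ℂ] ℂ :=
    { toFun := fun x => f (N x) (a x)
      map_add' := fun x y => by
        obtain ⟨l, a', b', h1, h2⟩ := h.exists_common (a x) (a y)
        rw [heq' _ _ _ _ h1.symm, heq' _ _ _ _ h2.symm, ← map_add]
        refine heq' _ _ _ _ ?_
        rw [ha, map_add, h1, h2, ha, ha]; rfl
      map_smul' := fun c x => by
        rw [RingHom.id_apply, ← map_smul]
        refine heq' _ _ _ _ ?_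
        rw [ha, map_smul, ha]; rfl }
  have hg : ∀ x : V, ‖g x‖ ≤ 1 * ‖x‖ := fun x => by
    rw [one_mul]
    refine (hbound _ _).trans ?_
    rw [ha]; rfl
  obtain ⟨F, hF1, hF2⟩ := exists_extension_norm_eq V (g.mkContinuous 1 hg)
  refine ⟨F, fun x => ?_, fun n x => ?_⟩
  · refine (F.le_of_opNorm_le (c := 1) ?_ x).trans_eq (one_mul _)
    rw [hF2]; exact LinearMap.mkContinuous_norm_le _ zero_le_one _
  · have := hF1 ⟨μ n x, n, x, rfl⟩
    exact this.trans (heq' _ _ _ _ (ha _))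

end Functional

/-! ### The spectrum of the associated diagonal -/

section LineBundle

variable {Z : Type u} [TopologicalSpace Z] {r : ℕ} {p : C(Z, Mat r)}

theorem scalar_add (p f g : C(Z, Mat r)) (x : Z) :
    scalar p (f + g) x = scalar p f x + scalar p g x := by
  change Mat.trace (p x * (f x + g x)) = _
  rw [mul_add, map_add]; rfl

theorem scalar_smul (p f : C(Z, Mat r)) (c : ℂ) (x : Z) :
    scalar p (c • f) x = c * scalar p f x := by
  change Mat.trace (p x * (c • f x)) = _
  rw [mul_smul_comm, map_smul]; rfl

theorem IsLineBundle.scalar_eq (hp : IsLineBundle p) {f : C(Z, Mat r)} {x : Z} {c : ℂ}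
    (h : p x * f x * p x = c • p x) : scalar p f x = c := by
  rw [hp.mul_mul_apply] at h
  exact smul_left_injective ℂ (hp.apply_ne_zero x) h

theorem IsLineBundle.scalar_mul (hp : IsLineBundle p) {f g : C(Z, Mat r)} (hf : p * f = f * p)
    (x : Z) : scalar p (f * g) x = scalar p f x * scalar p g x := by
  have hfx : p x * f x = f x * p x := congrArg (fun F : C(Z, Mat r) => F x) hf
  have h : p x * (f x * g x) * p x = (p x * f x * p x) * (p x * g x * p x) := by
    rw [mul_assoc (p x) (f x) (p x), ← hfx, ← mul_assoc (p x) (p x), hp.apply_mul_self, hfx]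
    simp only [mul_assoc]
    rw [← mul_assoc (p x) (p x), hp.apply_mul_self, ← mul_assoc (p x) (f x), hfx, mul_assoc]
  refine hp.scalar_eq (h.trans ?_)
  rw [hp.mul_mul_apply, hp.mul_mul_apply, smul_mul_smul_comm, hp.apply_mul_self]

end LineBundle

namespace Units

variable {S : Base.{u}} {U : Units S} {n : ℕ}

theorem coord_mulLine_same (i) (k : Fin (S.R n i)) (f : C(S.Z n i, ℂ)) (x) :
    coord (U.mulLine ⟨i, k⟩ f) i x = f x • U.p n i k x := by
  rw [mulLine, coord_incl_same]; rfl

theorem coord_mulLine_of_ne {i j : Fin (S.N n)} (h : j ≠ i) (k : Fin (S.R n i))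
    (f : C(S.Z n i, ℂ)) : coord (U.mulLine ⟨i, k⟩ f) j = 0 :=
  coord_incl_of_ne (i := i) h _

theorem mulLine_mem_diagonal (K : S.Idx n) (f : C(S.Z n K.1, ℂ)) :
    U.mulLine K f ∈ U.diagonal n := by
  obtain ⟨i, k⟩ := K
  rw [mem_diagonal_iff]
  refine (U.isPartition_line n).pinch_eq_of_commute ?_
  rintro ⟨i', l⟩
  refine ext_coord fun j => ?_
  rw [coord_mul, coord_mul]
  by_cases hj : j = i
  · subst hj
    by_cases hj' : j = i'
    · subst hj'
      ext1 x
      rw [ContinuousMap.mul_apply, ContinuousMap.mul_apply, coord_mulLine_same, coord_line_same,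
        mul_smul_comm, smul_mul_assoc]
      congr 1
      have h : U.p n j l * U.p n j k = U.p n j k * U.p n j l := by
        by_cases hkl : k = l
        · rw [hkl]
        · rw [U.p_orth n j k l hkl, U.p_orth n j l k (Ne.symm hkl)]
      exact congrArg (fun F : C(S.Z n j, Mat (S.r n j)) => F x) h
    · rw [coord_line_of_ne hj', mul_zero, zero_mul]
  · rw [coord_mulLine_of_ne hj, mul_zero, zero_mul]

theorem mulLine_mul (K : S.Idx n) (f g : C(S.Z n K.1, ℂ)) :
    U.mulLine K (f * g) = U.mulLine K f * U.mulLine K g := by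
  obtain ⟨i, k⟩ := K
  refine ext_coord fun j => ?_
  rw [coord_mul]
  by_cases hj : j = i
  · subst hj
    ext1 x
    rw [ContinuousMap.mul_apply, coord_mulLine_same, coord_mulLine_same, coord_mulLine_same,
      smul_mul_smul_comm, (U.p_line n j k).apply_mul_self]
    rfl
  · rw [coord_mulLine_of_ne hj, coord_mulLine_of_ne hj, zero_mul]

theorem mulLine_add (K : S.Idx n) (f g : C(S.Z n K.1, ℂ)) :
    U.mulLine K (f + g) = U.mulLine K f + U.mulLine K g := by
  obtain ⟨i, k⟩ := K
  refine ext_coord fun j => ?_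
  rw [coord_add]
  by_cases hj : j = i
  · subst hj
    ext1 x
    rw [ContinuousMap.add_apply, coord_mulLine_same, coord_mulLine_same, coord_mulLine_same,
      ← add_smul]
    rfl
  · rw [coord_mulLine_of_ne hj, coord_mulLine_of_ne hj, coord_mulLine_of_ne hj, zero_add]

theorem mulLine_smul (K : S.Idx n) (c : ℂ) (f : C(S.Z n K.1, ℂ)) :
    U.mulLine K (c • f) = c • U.mulLine K f := by
  obtain ⟨i, k⟩ := K
  refine ext_coord fun j => ?_
  rw [coord_smul]
  by_cases hj : j = i
  · subst hj
    ext1 x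
    rw [ContinuousMap.smul_apply, coord_mulLine_same, coord_mulLine_same, smul_smul]
    rfl
  · rw [coord_mulLine_of_ne hj, coord_mulLine_of_ne hj, smul_zero]

theorem mulLine_one (K : S.Idx n) : U.mulLine K 1 = U.line K := by
  obtain ⟨i, k⟩ := K
  refine ext_coord fun j => ?_
  by_cases hj : j = i
  · subst hj
    ext1 x
    rw [coord_mulLine_same, coord_line_same, ContinuousMap.one_apply, one_smul]
  · rw [coord_mulLine_of_ne hj, coord_line_of_ne hj]

/-- The scalar function by which `a` acts on a line bundle of stage `n`. -/
def lineScalar (K : S.Idx n) (a : U.Block n) : C(S.Z n K.1, ℂ) :=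
  scalar (U.p n K.1 K.2) (coord a K.1)

theorem lineScalar_mulLine (K : S.Idx n) (f : C(S.Z n K.1, ℂ)) (x) :
    lineScalar K (U.mulLine K f) x = f x := by
  obtain ⟨i, k⟩ := K
  refine (U.p_line n i k).scalar_eq ?_
  rw [coord_mulLine_same, mul_smul_comm, smul_mul_assoc, (U.p_line n i k).apply_mul_self,
    (U.p_line n i k).apply_mul_self]

theorem mul_line_of_mem_diagonal (K : S.Idx n) {a : U.Block n} (ha : a ∈ U.diagonal n) :
    a * U.line K = U.mulLine K (lineScalar K a) := by
  obtain ⟨i, k⟩ := K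
  refine ext_coord fun j => ?_
  rw [coord_mul]
  by_cases hj : j = i
  · subst hj
    ext1 x
    have h : coord a j * U.p n j k = U.p n j k * coord a j * U.p n j k := by
      rw [p_mul_coord_of_mem ha, mul_assoc, p_mul_self]
    rw [coord_mulLine_same, coord_line_same, h]
    exact (U.p_line n j k).mul_mul_apply _ x
  · rw [coord_mulLine_of_ne hj, coord_line_of_ne hj, mul_zero]

theorem line_mul_mul_line (K : S.Idx n) (a : U.Block n) :
    U.line K * a * U.line K = U.mulLine K (lineScalar K a) := by
  obtain ⟨i, k⟩ := K
  refine ext_coord fun j => ?_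
  rw [coord_mul, coord_mul]
  by_cases hj : j = i
  · subst hj
    ext1 x
    rw [coord_mulLine_same, coord_line_same]
    exact (U.p_line n j k).mul_mul_apply _ x
  · rw [coord_mulLine_of_ne hj, coord_line_of_ne hj, mul_zero]

end Units

namespace AHSystem

open AHCartan.Units

variable {S : Base.{u}} (𝒜 : AHSystem S) (π : S.Path)

/-- The eigenvalue functions along a path. -/
def pathMap (k : ℕ) : C(S.Z (k + 1) (π.node (k + 1)), S.Z k (π.node k)) :=
  𝒜.lam k (π.node (k + 1)) (π.node k) (π.edge k)

/-- A sequence of line bundles along a path, each of which is the tensor product of the pull-back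
of its predecessor with `q`. -/
def thread : ∀ k, Fin (S.R k (π.node k))
  | 0 => ⟨0, π.rank_pos 0⟩
  | k + 1 => (𝒜.exists_next_eq (j := π.node (k + 1))
      (α := ⟨⟨π.node k, π.edge k⟩, thread k⟩) (π.q_ne_zero k)).choose

/-- The indices of the line bundles `thread`. -/
abbrev threadIdx (k : ℕ) : S.Idx k := ⟨π.node k, 𝒜.thread π k⟩

theorem next_thread (k : ℕ) :
    𝒜.next (j := π.node (k + 1)) ⟨⟨π.node k, π.edge k⟩, 𝒜.thread π k⟩ =
      𝒜.p (k + 1) (π.node (k + 1)) (𝒜.thread π (k + 1)) :=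
  (𝒜.exists_next_eq (j := π.node (k + 1))
      (α := ⟨⟨π.node k, π.edge k⟩, 𝒜.thread π k⟩) (π.q_ne_zero k)).choose_spec

theorem term_mulLine_thread (k : ℕ) (f : C(S.Z k (π.node k), ℂ)) (x) :
    𝒜.term (j := π.node (k + 1)) ⟨π.node k, π.edge k⟩ (𝒜.mulLine (𝒜.threadIdx π k) f) x =
      f (𝒜.pathMap π k x) • 𝒜.p (k + 1) (π.node (k + 1)) (𝒜.thread π (k + 1)) x := by
  rw [← next_thread, next_apply, term, coord_mulLine_same, S.place_smul_left]
  rfl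

theorem term_line_thread (k : ℕ) (x) :
    𝒜.term (j := π.node (k + 1)) ⟨π.node k, π.edge k⟩ (𝒜.line (𝒜.threadIdx π k)) x =
      𝒜.p (k + 1) (π.node (k + 1)) (𝒜.thread π (k + 1)) x := by
  rw [← mulLine_one, term_mulLine_thread, ContinuousMap.one_apply, one_smul]

/-- The connecting map `C_k → C_(k + 1)`, restricted to the line bundles of the thread, is
composition with the eigenvalue function. -/
theorem lineScalar_φ (k : ℕ) (a : 𝒜.Block k) (x) :
    lineScalar (𝒜.threadIdx π (k + 1)) (𝒜.φ k a) x =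
      lineScalar (𝒜.threadIdx π k) a (𝒜.pathMap π k x) := by
  refine (𝒜.p_line _ _ _).scalar_eq ?_
  rw [← term_line_thread, term_mul_coord_φ, term_mul_term, line_mul_mul_line,
    term_mulLine_thread, term_line_thread]

theorem φ_mulLine_mul_line (k : ℕ) (f : C(S.Z k (π.node k), ℂ)) :
    𝒜.φ k (𝒜.mulLine (𝒜.threadIdx π k) f) * 𝒜.line (𝒜.threadIdx π (k + 1)) =
      𝒜.mulLine (𝒜.threadIdx π (k + 1)) (f.comp (𝒜.pathMap π k)) := by
  refine (mul_line_of_mem_diagonal (𝒜.threadIdx π (k + 1))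
    (φ_mem_diagonal k (mulLine_mem_diagonal (𝒜.threadIdx π k) f))).trans ?_
  congr 1
  ext1 x
  rw [lineScalar_φ, lineScalar_mulLine]
  rfl

end AHSystem

namespace AHSystem

open AHCartan.Units

variable {S : Base.{u}} (𝒜 : AHSystem S) (π : S.Path) {A : Type u} [NonUnitalCStarAlgebra A]
  {μ : ∀ n, 𝒜.Block n →⋆ₙₐ[ℂ] A}

theorem coe_assocDiagonal (hA : IsInductiveLimit 𝒜.φ μ) :
    (𝒜.assocDiagonal μ : Set A) = closure {x | ∃ n, ∃ a ∈ 𝒜.diagonal n, μ n a = x} := by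
  have hmono : Monotone fun n => (𝒜.diagonal n).map (μ n) := by
    refine monotone_nat_of_le_succ fun n => ?_
    rintro _ ⟨a, ha, rfl⟩
    exact ⟨𝒜.φ n a, φ_mem_diagonal n ha, hA.compatible n a⟩
  change closure ((⨆ n, (𝒜.diagonal n).map (μ n) : NonUnitalStarSubalgebra ℂ A) : Set A) = _
  rw [NonUnitalStarSubalgebra.coe_iSup_of_directed hmono.directed_le]
  congr 1
  ext x
  simp only [Set.mem_iUnion, Set.mem_ofPred_eq]
  rfl

theorem map_mem_assocDiagonal {n : ℕ} {a : 𝒜.Block n} (ha : a ∈ 𝒜.diagonal n) :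
    μ n a ∈ 𝒜.assocDiagonal μ :=
  NonUnitalStarSubalgebra.le_topologicalClosure _
    (le_iSup (fun n => (𝒜.diagonal n).map (μ n)) n ⟨a, ha, rfl⟩)

/-- The canonical map `C_n → C_A`. -/
def diagMap (μ : ∀ n, 𝒜.Block n →⋆ₙₐ[ℂ] A) (n : ℕ) :
    𝒜.diagonal n →⋆ₙₐ[ℂ] 𝒜.assocDiagonal μ where
  toFun a := ⟨μ n a, 𝒜.map_mem_assocDiagonal a.2⟩
  map_smul' c a := Subtype.ext (map_smul (μ n) c a.1)
  map_zero' := Subtype.ext (map_zero (μ n))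
  map_add' a b := Subtype.ext (map_add (μ n) a.1 b.1)
  map_mul' a b := Subtype.ext (map_mul (μ n) a.1 b.1)
  map_star' a := Subtype.ext (map_star (μ n) a.1)

theorem diagMap_φ (hA : IsInductiveLimit 𝒜.φ μ) (n : ℕ) (a : 𝒜.diagonal n) :
    𝒜.diagMap μ (n + 1) ⟨𝒜.φ n a, φ_mem_diagonal n a.2⟩ = 𝒜.diagMap μ n a :=
  Subtype.ext (hA.compatible n a)

/-- The canonical images of the `C_n` are dense in `C_A`. -/
theorem diagMap_induction (hA : IsInductiveLimit 𝒜.φ μ) {P : 𝒜.assocDiagonal μ → Prop}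
    (hP : IsClosed {c | P c}) (h : ∀ n a, P (𝒜.diagMap μ n a)) (c : 𝒜.assocDiagonal μ) : P c := by
  have hd : Dense {c : 𝒜.assocDiagonal μ | ∃ n a, 𝒜.diagMap μ n a = c} := by
    intro c
    rw [closure_subtype]
    have hc : c.1 ∈ closure {x | ∃ n, ∃ a ∈ 𝒜.diagonal n, μ n a = x} := by
      rw [← 𝒜.coe_assocDiagonal hA]; exact c.2
    refine closure_mono ?_ hc
    rintro _ ⟨n, a, ha, rfl⟩
    exact ⟨𝒜.diagMap μ n ⟨a, ha⟩, ⟨n, ⟨a, ha⟩, rfl⟩, rfl⟩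
  refine (closure_minimal (s := {c : 𝒜.assocDiagonal μ | ∃ n a, 𝒜.diagMap μ n a = c}) ?_ hP) (hd c)
  rintro _ ⟨n, a, rfl⟩
  exact h n a

theorem diagMap_exists_common (hA : IsInductiveLimit 𝒜.φ μ) {n m : ℕ} (a : 𝒜.diagonal n)
    (b : 𝒜.diagonal m) : ∃ l, ∃ a' b' : 𝒜.diagonal l,
      𝒜.diagMap μ l a' = 𝒜.diagMap μ n a ∧ 𝒜.diagMap μ l b' = 𝒜.diagMap μ m b := by
  have hup : ∀ n d, ∀ a : 𝒜.diagonal n, ∃ a' : 𝒜.diagonal (n + d),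
      𝒜.diagMap μ (n + d) a' = 𝒜.diagMap μ n a := by
    intro n d a
    induction d with
    | zero => exact ⟨a, rfl⟩
    | succ d ih =>
      obtain ⟨a', ha'⟩ := ih
      exact ⟨⟨𝒜.φ (n + d) a', φ_mem_diagonal (n + d) a'.2⟩, (𝒜.diagMap_φ hA (n + d) a').trans ha'⟩
  rcases le_total n m with h | h
  · obtain ⟨d, rfl⟩ := Nat.exists_eq_add_of_le h
    obtain ⟨a', ha'⟩ := hup n d a
    exact ⟨_, a', b, ha', rfl⟩
  · obtain ⟨d, rfl⟩ := Nat.exists_eq_add_of_le h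
    obtain ⟨b', hb'⟩ := hup m d b
    exact ⟨_, a, b', rfl, hb'⟩

/-- The evaluation functional on `A_k` at a point of the inverse limit along a path. -/
def evalLine (z : π.InvLim (𝒜.pathMap π)) (k : ℕ) : 𝒜.Block k →ₗ[ℂ] ℂ where
  toFun a := lineScalar (𝒜.threadIdx π k) a (z.1 k)
  map_add' _ _ := scalar_add _ _ _ _
  map_smul' _ _ := scalar_smul _ _ _ _

theorem evalLine_φ (z : π.InvLim (𝒜.pathMap π)) (k : ℕ) (a : 𝒜.Block k) :
    𝒜.evalLine π z (k + 1) (𝒜.φ k a) = 𝒜.evalLine π z k a := by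
  change lineScalar (𝒜.threadIdx π (k + 1)) (𝒜.φ k a) (z.1 (k + 1)) = _
  rw [lineScalar_φ, z.2 k]; rfl

theorem norm_evalLine_le (z : π.InvLim (𝒜.pathMap π)) (k : ℕ) (a : 𝒜.Block k) :
    ‖𝒜.evalLine π z k a‖ ≤ ‖a‖ :=
  ((𝒜.p_line _ _ _).norm_scalar_le _ _).trans (norm_coord_apply_le _ _ _)

theorem evalLine_mul (z : π.InvLim (𝒜.pathMap π)) (k : ℕ) {a : 𝒜.Block k}
    (ha : a ∈ 𝒜.diagonal k) (b : 𝒜.Block k) :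
    𝒜.evalLine π z k (a * b) = 𝒜.evalLine π z k a * 𝒜.evalLine π z k b :=
  (𝒜.p_line _ _ _).scalar_mul (p_mul_coord_of_mem ha _ _) _

theorem evalLine_mulLine (z : π.InvLim (𝒜.pathMap π)) (k : ℕ) (f : C(S.Z k (π.node k), ℂ)) :
    𝒜.evalLine π z k (𝒜.mulLine (𝒜.threadIdx π k) f) = f (z.1 k) :=
  lineScalar_mulLine (𝒜.threadIdx π k) f (z.1 k)

/-- The points of the inverse limit define characters of `C_A`. -/
theorem exists_character (hA : IsInductiveLimit 𝒜.φ μ) (z : π.InvLim (𝒜.pathMap π)) :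
    ∃ χ : Spec (𝒜.assocDiagonal μ), (∀ c, ‖χ c‖ ≤ ‖c‖) ∧
      ∀ n a, χ (𝒜.diagMap μ n a) = 𝒜.evalLine π z n a := by
  obtain ⟨F, hF1, hF2⟩ := hA.exists_functional (𝒜.evalLine π z) (𝒜.evalLine_φ π z)
    (𝒜.norm_evalLine_le π z)
  let G : 𝒜.assocDiagonal μ →L[ℂ] ℂ :=
    { toFun := fun c => F c.1
      map_add' := fun a b => map_add F a.1 b.1
      map_smul' := fun c a => map_smul F c a.1
      cont := F.continuous.comp continuous_subtype_val }
  have hG : ∀ n a, G (𝒜.diagMap μ n a) = 𝒜.evalLine π z n a := fun n a => hF2 n a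
  refine ⟨⟨StrongDual.toWeakDual G, ?_, ?_⟩, fun c => hF1 c, hG⟩
  · intro h0
    have h1 : G (𝒜.diagMap μ 0 ⟨_, mulLine_mem_diagonal (𝒜.threadIdx π 0) 1⟩) = 0 :=
      DFunLike.congr_fun h0 _
    rw [hG, evalLine_mulLine] at h1
    exact one_ne_zero h1
  · intro x y
    change G (x * y) = G x * G y
    refine 𝒜.diagMap_induction hA (P := fun x => G (x * y) = G x * G y) ?_ (fun n a => ?_) x
    · exact isClosed_eq (G.continuous.comp (continuous_id.mul continuous_const))
        (G.continuous.mul continuous_const)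
    · refine 𝒜.diagMap_induction hA
        (P := fun y => G (𝒜.diagMap μ n a * y) = G (𝒜.diagMap μ n a) * G y) ?_ (fun m b => ?_) y
      · exact isClosed_eq (G.continuous.comp (continuous_const.mul continuous_id))
          (continuous_const.mul G.continuous)
      · obtain ⟨l, a', b', h1, h2⟩ := 𝒜.diagMap_exists_common hA a b
        rw [← h1, ← h2, ← map_mul, hG, hG, hG]
        exact 𝒜.evalLine_mul π z l a'.2 _

/-- The map from the inverse limit along a path to the spectrum of `C_A`. -/
def toSpec (hA : IsInductiveLimit 𝒜.φ μ) (z : π.InvLim (𝒜.pathMap π)) :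
    Spec (𝒜.assocDiagonal μ) := (𝒜.exists_character π hA z).choose

theorem norm_toSpec_le (hA : IsInductiveLimit 𝒜.φ μ) (z : π.InvLim (𝒜.pathMap π)) (c) :
    ‖𝒜.toSpec π hA z c‖ ≤ ‖c‖ := (𝒜.exists_character π hA z).choose_spec.1 c

theorem toSpec_diagMap (hA : IsInductiveLimit 𝒜.φ μ) (z : π.InvLim (𝒜.pathMap π)) (n a) :
    𝒜.toSpec π hA z (𝒜.diagMap μ n a) = 𝒜.evalLine π z n a :=
  (𝒜.exists_character π hA z).choose_spec.2 n a

theorem continuous_toSpec (hA : IsInductiveLimit 𝒜.φ μ) : Continuous (𝒜.toSpec π hA) := by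
  refine Continuous.subtype_mk (WeakDual.continuous_of_continuous_eval fun c => ?_) _
  change Continuous fun z => 𝒜.toSpec π hA z c
  refine 𝒜.diagMap_induction hA (P := fun c => Continuous fun z => 𝒜.toSpec π hA z c) ?_ ?_ c
  · rw [← closure_subset_iff_isClosed]
    intro c hc
    refine continuous_of_uniform_approx_of_continuous fun u hu => ?_
    obtain ⟨ε, hε, hu⟩ := Metric.mem_uniformity_dist.1 hu
    obtain ⟨c', hc', h⟩ := Metric.mem_closure_iff.1 hc ε hε
    refine ⟨_, hc', fun z => hu ?_⟩
    rw [dist_eq_norm, ← map_sub]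
    exact (𝒜.norm_toSpec_le π hA z _).trans_lt (by rwa [← dist_eq_norm])
  · intro n a
    simp only [toSpec_diagMap]
    exact (lineScalar (𝒜.threadIdx π n) a.1).continuous.comp (π.continuous_invLim_apply _ n)

theorem injective_toSpec (hA : IsInductiveLimit 𝒜.φ μ) : Function.Injective (𝒜.toSpec π hA) := by
  intro z z' h
  refine Subtype.ext (funext fun k => ?_)
  refine (WeakDual.CharacterSpace.continuousMapEval_bijective (X := S.Z k (π.node k))
    (𝕜 := ℂ)).1 (DFunLike.ext _ _ fun f => ?_)
  change f (z.1 k) = f (z'.1 k)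
  rw [← 𝒜.evalLine_mulLine π z, ← 𝒜.evalLine_mulLine π z']
  have hf := mulLine_mem_diagonal (U := 𝒜.toUnits) (𝒜.threadIdx π k) f
  rw [← 𝒜.toSpec_diagMap π hA z k ⟨_, hf⟩, ← 𝒜.toSpec_diagMap π hA z' k ⟨_, hf⟩, h]

/-- The multiples `f p` of a line bundle along the path, as elements of `C_n`. -/
def pathElem (k : ℕ) (f : C(S.Z k (π.node k), ℂ)) : 𝒜.diagonal k :=
  ⟨𝒜.mulLine (𝒜.threadIdx π k) f, mulLine_mem_diagonal (𝒜.threadIdx π k) f⟩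

theorem evalLine_pathElem (z : π.InvLim (𝒜.pathMap π)) (k : ℕ) (f : C(S.Z k (π.node k), ℂ)) :
    𝒜.evalLine π z k (𝒜.pathElem π k f) = f (z.1 k) := 𝒜.evalLine_mulLine π z k f

theorem mul_pathElem_one (k : ℕ) (a : 𝒜.diagonal k) :
    a * 𝒜.pathElem π k 1 = 𝒜.pathElem π k (lineScalar (𝒜.threadIdx π k) a.1) := by
  refine Subtype.ext ?_
  change a.1 * 𝒜.mulLine (𝒜.threadIdx π k) 1 = _
  rw [mulLine_one, mul_line_of_mem_diagonal _ a.2]; rfl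

/-- A character that takes the value one at all line bundles of the path comes from a point of the
inverse limit. -/
theorem mem_range_toSpec (hA : IsInductiveLimit 𝒜.φ μ) (χ : Spec (𝒜.assocDiagonal μ))
    (hχ : ∀ k, χ (𝒜.diagMap μ k (𝒜.pathElem π k 1)) = 1) : χ ∈ Set.range (𝒜.toSpec π hA) := by
  -- The restriction of `χ` to the `k`-th line bundle is a character of `C(Z_k)`, hence a point.
  have hpt : ∀ k, ∃ x : S.Z k (π.node k), ∀ f, χ (𝒜.diagMap μ k (𝒜.pathElem π k f)) = f x := by
    intro k
    let ψ : C(S.Z k (π.node k), ℂ) →ₐ[ℂ] ℂ := AlgHom.ofLinearMap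
      { toFun := fun f => χ (𝒜.diagMap μ k (𝒜.pathElem π k f))
        map_add' := fun f g => by
          have h : 𝒜.pathElem π k (f + g) = 𝒜.pathElem π k f + 𝒜.pathElem π k g :=
            Subtype.ext (mulLine_add (𝒜.threadIdx π k) f g)
          rw [h, map_add, map_add]
        map_smul' := fun c f => by
          have h : 𝒜.pathElem π k (c • f) = c • 𝒜.pathElem π k f :=
            Subtype.ext (mulLine_smul (𝒜.threadIdx π k) c f)
          rw [h, map_smul, map_smul, RingHom.id_apply] }
      (hχ k) (fun f g => by
          have h : 𝒜.pathElem π k (f * g) = 𝒜.pathElem π k f * 𝒜.pathElem π k g :=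
            Subtype.ext (mulLine_mul (𝒜.threadIdx π k) f g)
          change χ _ = χ _ * χ _
          rw [h, map_mul, map_mul])
    obtain ⟨x, hx⟩ := (WeakDual.CharacterSpace.continuousMapEval_bijective
      (X := S.Z k (π.node k)) (𝕜 := ℂ)).2 (WeakDual.CharacterSpace.equivAlgHom.symm ψ)
    refine ⟨x, fun f => ?_⟩
    have := DFunLike.congr_fun hx f
    exact this.symm
  choose x hx using hpt
  have hcompat : ∀ k, 𝒜.pathMap π k (x (k + 1)) = x k := by
    intro k
    refine (WeakDual.CharacterSpace.continuousMapEval_bijective (X := S.Z k (π.node k))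
      (𝕜 := ℂ)).1 (DFunLike.ext _ _ fun f => ?_)
    change f (𝒜.pathMap π k (x (k + 1))) = f (x k)
    rw [← hx k f, ← 𝒜.diagMap_φ hA]
    have h1 := hx (k + 1) (f.comp (𝒜.pathMap π k))
    have h2 : 𝒜.pathElem π (k + 1) (f.comp (𝒜.pathMap π k)) =
        ⟨𝒜.φ k (𝒜.pathElem π k f), φ_mem_diagonal k (𝒜.pathElem π k f).2⟩ *
          𝒜.pathElem π (k + 1) 1 := by
      refine Subtype.ext ?_
      change _ = 𝒜.φ k (𝒜.mulLine (𝒜.threadIdx π k) f) * 𝒜.mulLine (𝒜.threadIdx π (k + 1)) 1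
      rw [mulLine_one, φ_mulLine_mul_line]
      rfl
    rw [h2, map_mul, map_mul, hχ, mul_one] at h1
    exact h1.symm
  let z : π.InvLim (𝒜.pathMap π) := ⟨x, hcompat⟩
  refine ⟨z, DFunLike.ext _ _ fun c => ?_⟩
  refine 𝒜.diagMap_induction hA (P := fun c => 𝒜.toSpec π hA z c = χ c)
    (isClosed_eq (map_continuous _) (map_continuous χ)) (fun n a => ?_) c
  rw [toSpec_diagMap]
  have h := hχ n
  rw [← mul_one (χ _), ← h, ← map_mul, ← map_mul, mul_pathElem_one, hx]
  rfl

/-- The inverse limit along a path of the base spaces, with the eigenvalue functions as bonding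
maps, is homeomorphic to a connected component of the spectrum of `C_A`. -/
theorem exists_connectedComponent (hA : IsInductiveLimit 𝒜.φ μ) :
    ∃ χ : Spec (𝒜.assocDiagonal μ),
      Nonempty (connectedComponent χ ≃ₜ π.InvLim (𝒜.pathMap π)) := by
  have := π.connectedSpace_invLim (𝒜.pathMap π)
  have := π.compactSpace_invLim (𝒜.pathMap π)
  obtain ⟨z⟩ : Nonempty (π.InvLim (𝒜.pathMap π)) := inferInstance
  have hcomp : connectedComponent (𝒜.toSpec π hA z) = Set.range (𝒜.toSpec π hA) := by
    refine subset_antisymm (fun χ hχ => 𝒜.mem_range_toSpec π hA χ fun k => ?_)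
      ((isPreconnected_range (𝒜.continuous_toSpec π hA)).subset_connectedComponent ⟨z, rfl⟩)
    set P := 𝒜.diagMap μ k (𝒜.pathElem π k 1)
    have hev : Continuous fun χ : Spec (𝒜.assocDiagonal μ) => χ P :=
      (WeakDual.eval_continuous P).comp continuous_subtype_val
    have hidem : ∀ χ : Spec (𝒜.assocDiagonal μ), χ P * χ P = χ P := fun χ => by
      have h : 𝒜.pathElem π k 1 * 𝒜.pathElem π k 1 = 𝒜.pathElem π k 1 :=
        Subtype.ext ((mulLine_mul (𝒜.threadIdx π k) 1 1).symm.trans (by rw [one_mul]; rfl))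
      rw [← map_mul, ← map_mul, h]
    -- As `P` is idempotent, `χ P = 1` is equivalent to the open condition `χ P ≠ 0`.
    have hclopen : IsClopen {χ : Spec (𝒜.assocDiagonal μ) | χ P = 1} := by
      refine ⟨isClosed_singleton.preimage hev, ?_⟩
      have h : {χ : Spec (𝒜.assocDiagonal μ) | χ P = 1} =
          (fun χ : Spec (𝒜.assocDiagonal μ) => χ P) ⁻¹' {0}ᶜ := by
        ext χ
        refine ⟨fun h => ?_, fun h => ?_⟩
        · change χ P ≠ 0
          rw [show χ P = 1 from h]; exact one_ne_zero
        · exact mul_left_cancel₀ h ((hidem χ).trans (mul_one _).symm)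
      rw [h]
      exact isOpen_compl_singleton.preimage hev
    refine hclopen.connectedComponent_subset ?_ hχ
    change 𝒜.toSpec π hA z P = 1
    rw [toSpec_diagMap, evalLine_pathElem]; rfl
  have hemb := ((𝒜.continuous_toSpec π hA).isClosedEmbedding
    (𝒜.injective_toSpec π hA)).isEmbedding
  exact ⟨𝒜.toSpec π hA z, ⟨(Homeomorph.setCongr hcomp).trans hemb.toHomeomorph.symm⟩⟩

end AHSystem

/-- Isomorphisms of pairs induce homeomorphisms of spectra. -/
theorem nonempty_spec_homeomorph {A B : Type u} [NonUnitalCStarAlgebra A]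
    [NonUnitalCStarAlgebra B] {C : NonUnitalStarSubalgebra ℂ A} {D : NonUnitalStarSubalgebra ℂ B}
    (f : A ≃⋆ₐ[ℂ] B) (hf : f '' (C : Set A) = (D : Set B)) : Nonempty (Spec C ≃ₜ Spec D) := by
  have key : ∀ {A B : Type u} [NonUnitalCStarAlgebra A] [NonUnitalCStarAlgebra B]
      {C : NonUnitalStarSubalgebra ℂ A} {D : NonUnitalStarSubalgebra ℂ B} (f : A ≃⋆ₐ[ℂ] B)
      (h1 : ∀ c ∈ C, f c ∈ D) (h2 : ∀ d ∈ D, f.symm d ∈ C),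
      ∃ F : Spec D → Spec C, Continuous F ∧ ∀ χ c, F χ c = χ ⟨f c.1, h1 c.1 c.2⟩ := by
    intro A B _ _ C D f h1 h2
    have hcont : Continuous f := (StarAlgEquiv.isometry f).continuous
    let g : C →L[ℂ] D :=
      { toFun := fun c => ⟨f c.1, h1 c.1 c.2⟩
        map_add' := fun a b => Subtype.ext (map_add f a.1 b.1)
        map_smul' := fun c a => Subtype.ext (map_smul f c a.1)
        cont := Continuous.subtype_mk (hcont.comp continuous_subtype_val) _ }
    have hg : ∀ a b, g (a * b) = g a * g b := fun a b => Subtype.ext (map_mul f a.1 b.1)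
    have hs : Function.Surjective g := fun d =>
      ⟨⟨f.symm d.1, h2 d.1 d.2⟩, Subtype.ext (f.apply_symm_apply d.1)⟩
    refine ⟨fun χ => ⟨StrongDual.toWeakDual ((WeakDual.toStrongDual χ.1).comp g), ?_, ?_⟩, ?_,
      fun _ _ => rfl⟩
    · intro h0
      refine χ.2.1 (DFunLike.ext _ _ fun d => ?_)
      obtain ⟨c, rfl⟩ := hs d
      exact DFunLike.congr_fun h0 c
    · intro a b
      change χ (g (a * b)) = χ (g a) * χ (g b)
      rw [hg, map_mul]
    · refine Continuous.subtype_mk (WeakDual.continuous_of_continuous_eval fun c => ?_) _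
      exact (WeakDual.eval_continuous (g c)).comp continuous_subtype_val
  have h1 : ∀ c ∈ C, f c ∈ D := fun c hc => by
    have : f c ∈ (D : Set B) := hf ▸ ⟨c, hc, rfl⟩
    exact this
  have h2 : ∀ d ∈ D, f.symm d ∈ C := fun d hd => by
    have : d ∈ f '' (C : Set A) := hf ▸ hd
    obtain ⟨c, hc, rfl⟩ := this
    rw [f.symm_apply_apply]; exact hc
  obtain ⟨F, hF, hF'⟩ := key f h1 h2
  obtain ⟨G, hG, hG'⟩ := key f.symm h2 (fun c hc => by rw [StarAlgEquiv.symm_symm]; exact h1 c hc)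
  refine ⟨⟨⟨G, F, fun χ => ?_, fun χ => ?_⟩, hG, hF⟩⟩
  · refine DFunLike.ext _ _ fun c => ?_
    rw [hF', hG']
    exact congrArg χ (Subtype.ext (f.symm_apply_apply c.1))
  · refine DFunLike.ext _ _ fun c => ?_
    rw [hG', hF']
    exact congrArg χ (Subtype.ext (f.apply_symm_apply c.1))

end AHCartan

end

theorem proposition3p6 {S : AHCartan.Base.{u}}
    (𝒜 : AHCartan.AHSystem S) (h𝒜 : ∀ n, Function.Injective (𝒜.φ n))
    {A : Type u} [NonUnitalCStarAlgebra A] (μ : ∀ n, 𝒜.Block n →⋆ₙₐ[ℂ] A)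
    (hA : AHCartan.IsInductiveLimit 𝒜.φ μ)
    (π : S.Path) (γ : ∀ k, C(S.Z (k + 1) (π.node (k + 1)), S.Z k (π.node k)))
    (hγ : 𝒜.IsUnseenComponent μ π γ)
    (ℬ : AHCartan.AHSystem S) (hℬ : 𝒜.IsPathReplacement π γ ℬ)
    {B : Type u} [NonUnitalCStarAlgebra B] (ν : ∀ n, ℬ.Block n →⋆ₙₐ[ℂ] B)
    (hB : AHCartan.IsInductiveLimit ℬ.φ ν)
    (hAB : Nonempty (A ≃⋆ₐ[ℂ] B)) :
    IsEmpty (AHCartan.Spec (𝒜.assocDiagonal μ) ≃ₜ AHCartan.Spec (ℬ.assocDiagonal ν)) ∧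
      ¬ AHCartan.AdmitsAHUniqueCartan A := by
  have hspec : IsEmpty
      (AHCartan.Spec (𝒜.assocDiagonal μ) ≃ₜ AHCartan.Spec (ℬ.assocDiagonal ν)) := by
    refine ⟨fun e => ?_⟩
    obtain rfl : ℬ.pathMap π = γ := funext hℬ.on_path
    obtain ⟨χ, ⟨h⟩⟩ := ℬ.exists_connectedComponent π hB
    refine (hγ (e.symm χ)).false ?_
    have himage : e.symm '' connectedComponent χ = connectedComponent (e.symm χ) := by
      refine subset_antisymm (e.symm.continuous.image_connectedComponent_subset χ) fun x hx => ?_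
      refine ⟨e x, ?_, e.symm_apply_apply x⟩
      have := e.continuous.image_connectedComponent_subset (e.symm χ) ⟨x, hx, rfl⟩
      rwa [e.apply_symm_apply] at this
    exact (Homeomorph.setCongr himage.symm).trans ((e.symm.image _).symm.trans h)
  refine ⟨hspec, ?_⟩
  rintro ⟨C, -, hC⟩
  obtain ⟨f, hf⟩ := hC A _ (AHCartan.AHSystem.isAHIndLimCartan_assocDiagonal hA)
    ⟨StarAlgEquiv.refl ℂ A⟩
  obtain ⟨g, hg⟩ := hC B _ (AHCartan.AHSystem.isAHIndLimCartan_assocDiagonal hB) hAB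
  obtain ⟨e⟩ := AHCartan.nonempty_spec_homeomorph f hf
  obtain ⟨e'⟩ := AHCartan.nonempty_spec_homeomorph g hg
  exact hspec.false (e.symm.trans e')
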